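/- Let $(M,g,J)$ be a Kähler manifold (a finite-dimensional smooth manifold with a smooth Riemannian metric $g$ and a smooth $g$-orthogonal almost complex structure $J$ that is parallel for the Levi-Civita connection $\nabla$ of $g$), and let $\rho$ be its Ricci tensor. Let $\tau\in C^\infty(M)$ be a special Kähler potential: $\tau$ is nonconstant, $X=J(\nabla\tau)$ is a Killing vector field, and at every point with $d\tau\neq 0$ all nonzero tangent vectors orthogonal to $X$ and $JX$ are eigenvectors of the Hessian $\nabla d\tau$. Put $U=\{x\in M: d\tau(x)\neq 0\}$ and let $\mathcal F$ be the foliation of $U$ tangent to the distribution $\mathcal V=\mathrm{span}\{\nabla\tau,J\nabla\tau\}$. Then the following are equivalent. 1. $\mathcal F$ is a totally geodesic, holomorphic, complex homothetic foliation by curves on $U$, that is: - (complex foliation by curves) $\mathcal V$ is a smooth, involutive distribution of real rank $2$ on $U$ with $J\mathcal V=\mathcal V$; - (totally geodesic) $\nabla_V V'\in\Gamma(\mathcal V)$ for all local sections $V,V'\in\Gamma(\mathcal V)$; - (holomorphic) $(L_VJ)(TM)\subset\mathcal V$ for every local section $V\in\Gamma(\mathcal V)$; - (homothetic) there is a smooth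 one-form $\alpha$ on $U$, vanishing on $\mathcal V^\perp$, with $d\alpha=0$ and $L_Vg=\alpha(V)\,g$ on $\mathcal V^\perp$ for every local section $V\in\Gamma(\mathcal V)$. 2. At every point of $U$ the vector $X=J(\nabla\tau)$ is an eigenvector of the Ricci tensor: for every $x\in U$ there is $c\in\mathbb R$ with $\rho(X_x,w)=c\,g(X_x,w)$ for all $w\in T_xM$. -/

import Mathlib

open Bundle VectorField
open scoped Manifold ContDiff Topology RealInnerProductSpace

set_option linter.unusedSectionVars false

namespace KahlerFoliation

noncomputable section

variable
  {E : Type*} [NormedAddCommGroup E] [NormedSpace ℝ E] [FiniteDimensional ℝ E]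
  {M : Type*} [TopologicalSpace M] [ChartedSpace E M] [IsManifold 𝓘(ℝ, E) ∞ M]
  [RiemannianBundle (fun x : M ↦ TangentSpace 𝓘(ℝ, E) x)]
  [IsContMDiffRiemannianBundle 𝓘(ℝ, E) ∞ E (fun x : M ↦ TangentSpace 𝓘(ℝ, E) x)]

/-! ### The Levi-Civita connection, built from the Koszul formula -/

theorem mdiffAt_inner {X Y : Π x : M, TangentSpace 𝓘(ℝ, E) x} {x : M}
    (hX : MDiffAt (T% X) x) (hY : MDiffAt (T% Y) x) : MDiffAt (fun y ↦ ⟪X y, Y y⟫) x :=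
  MDifferentiableAt.inner_bundle (E := fun x : M ↦ TangentSpace 𝓘(ℝ, E) x) (b := fun x ↦ x) hX hY

/-- Koszul's expression for `g(∇_X Y, Z)` at `x`. -/
def koszul (X Y Z : Π x : M, TangentSpace 𝓘(ℝ, E) x) (x : M) : ℝ :=
  (1 / 2 : ℝ) *
    (d% (fun y ↦ ⟪Y y, Z y⟫) x (X x) + d% (fun y ↦ ⟪X y, Z y⟫) x (Y x)
      - d% (fun y ↦ ⟪X y, Y y⟫) x (Z x)
      + ⟪mlieBracket 𝓘(ℝ, E) X Y x, Z x⟫ - ⟪mlieBracket 𝓘(ℝ, E) X Z x, Y x⟫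
      - ⟪mlieBracket 𝓘(ℝ, E) Y Z x, X x⟫)

theorem koszul_tensorial_left {Y Z : Π x : M, TangentSpace 𝓘(ℝ, E) x} {x : M}
    (hY : MDiffAt (T% Y) x) (hZ : MDiffAt (T% Z) x) :
    TensorialAt 𝓘(ℝ, E) E (fun X ↦ koszul X Y Z x) x where
  smul {f X} hf hX := by
    simp [koszul, inner_smul_left, mvfderiv_fun_mul hf (mdiffAt_inner hX hY),
      mvfderiv_fun_mul hf (mdiffAt_inner hX hZ), mlieBracket_smul_left hf hX, inner_add_left,
      inner_smul_right]
    rw [real_inner_comm (Y x) (X x), real_inner_comm (Z x) (X x)]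
    ring
  add {X X'} hX hX' := by
    simp [koszul, inner_add_left, mvfderiv_fun_add (mdiffAt_inner hX hY) (mdiffAt_inner hX' hY),
      mvfderiv_fun_add (mdiffAt_inner hX hZ) (mdiffAt_inner hX' hZ),
      mlieBracket_add_left hX hX', inner_add_right]
    ring

theorem koszul_tensorial_right {X Y : Π x : M, TangentSpace 𝓘(ℝ, E) x} {x : M}
    (hX : MDiffAt (T% X) x) (hY : MDiffAt (T% Y) x) :
    TensorialAt 𝓘(ℝ, E) E (fun Z ↦ koszul X Y Z x) x where
  smul {f Z} hf hZ := by
    simp [koszul, inner_smul_right, mvfderiv_fun_mul hf (mdiffAt_inner hX hZ),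
      mvfderiv_fun_mul hf (mdiffAt_inner hY hZ), mlieBracket_smul_right hf hZ, inner_add_left,
      inner_smul_left]
    rw [real_inner_comm (Z x) (Y x), real_inner_comm (Z x) (X x)]
    ring
  add {Z Z'} hZ hZ' := by
    simp [koszul, inner_add_right, mvfderiv_fun_add (mdiffAt_inner hX hZ) (mdiffAt_inner hX hZ'),
      mvfderiv_fun_add (mdiffAt_inner hY hZ) (mdiffAt_inner hY hZ'),
      mlieBracket_add_right hZ hZ', inner_add_left]
    ring

theorem koszul_leibniz {X Y Z : Π x : M, TangentSpace 𝓘(ℝ, E) x} {f : M → ℝ} {x : M}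
    (hX : MDiffAt (T% X) x) (hY : MDiffAt (T% Y) x) (hZ : MDiffAt (T% Z) x) (hf : MDiffAt f x) :
    koszul X (f • Y) Z x = f x * koszul X Y Z x + d% f x (X x) * ⟪Y x, Z x⟫ := by
  simp [koszul, inner_smul_right, inner_smul_left, mvfderiv_fun_mul hf (mdiffAt_inner hX hY),
      mvfderiv_fun_mul hf (mdiffAt_inner hY hZ), mlieBracket_smul_right hf hY,
      mlieBracket_smul_left hf hY, inner_add_left]
  rw [real_inner_comm (X x) (Y x)]
  ring

theorem koszul_add {X Y Y' Z : Π x : M, TangentSpace 𝓘(ℝ, E) x} {x : M}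
    (hX : MDiffAt (T% X) x) (hY : MDiffAt (T% Y) x) (hY' : MDiffAt (T% Y') x)
    (hZ : MDiffAt (T% Z) x) :
    koszul X (Y + Y') Z x = koszul X Y Z x + koszul X Y' Z x := by
  simp [koszul, inner_add_right, inner_add_left,
      mvfderiv_fun_add (mdiffAt_inner hX hY) (mdiffAt_inner hX hY'),
      mvfderiv_fun_add (mdiffAt_inner hY hZ) (mdiffAt_inner hY' hZ),
      mlieBracket_add_right hY hY', mlieBracket_add_left hY hY']
  ring

/-- The bilinear form `(u, w) ↦ g(∇_u Y, w)` on the tangent space at a point where `Y` is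
differentiable. -/
def koszulForm (Y : Π x : M, TangentSpace 𝓘(ℝ, E) x) (x : M) (hY : MDiffAt (T% Y) x) :
    TangentSpace 𝓘(ℝ, E) x →L[ℝ] TangentSpace 𝓘(ℝ, E) x →L[ℝ] ℝ :=
  TensorialAt.mkHom₂ (I := 𝓘(ℝ, E)) (F := E) (F' := E) (fun X Z ↦ koszul X Y Z x) x
    (fun _ hZ ↦ koszul_tensorial_left hY hZ) (fun _ hX ↦ koszul_tensorial_right hX hY)

instance finiteDimensional_tangentSpace (x : M) :
    FiniteDimensional ℝ (TangentSpace 𝓘(ℝ, E) x) :=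
  inferInstanceAs (FiniteDimensional ℝ E)

instance completeSpace_tangentSpace (x : M) : CompleteSpace (TangentSpace 𝓘(ℝ, E) x) :=
  FiniteDimensional.complete ℝ _

theorem eq_of_inner_eq {x : M} {u v : TangentSpace 𝓘(ℝ, E) x}
    (h : ∀ w : TangentSpace 𝓘(ℝ, E) x, ⟪u, w⟫ = ⟪v, w⟫) : u = v :=
  ext_inner_right ℝ h

/-- The vector that represents a linear form through the metric (raising an index). -/
def sharp {x : M} (φ : TangentSpace 𝓘(ℝ, E) x →L[ℝ] ℝ) : TangentSpace 𝓘(ℝ, E) x :=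
  (InnerProductSpace.toDual ℝ (TangentSpace 𝓘(ℝ, E) x)).symm φ

theorem sharp_inner {x : M} (φ : TangentSpace 𝓘(ℝ, E) x →L[ℝ] ℝ) (w : TangentSpace 𝓘(ℝ, E) x) :
    ⟪sharp φ, w⟫ = φ w :=
  InnerProductSpace.toDual_symm_apply

open Classical in
/-- `nabla Y x u` is `∇_u Y` at `x`: the vector with `g(∇_u Y, w) = koszulForm Y x u w` for all
`w`. The value at a point where `Y` is not differentiable is irrelevant and set to `0`. -/
def nabla (Y : Π x : M, TangentSpace 𝓘(ℝ, E) x) (x : M) :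
    TangentSpace 𝓘(ℝ, E) x →L[ℝ] TangentSpace 𝓘(ℝ, E) x :=
  if hY : MDiffAt (T% Y) x then
    LinearMap.toContinuousLinearMap
      { toFun := fun u ↦ sharp (koszulForm Y x hY u)
        map_add' := fun u v ↦ eq_of_inner_eq fun w ↦ by
          simp [sharp_inner, inner_add_left]
        map_smul' := fun c u ↦ eq_of_inner_eq fun w ↦ by
          simp [sharp_inner, inner_smul_left] }
  else 0

theorem inner_nabla {Y : Π x : M, TangentSpace 𝓘(ℝ, E) x} {x : M} (hY : MDiffAt (T% Y) x)
    {X Z : Π x : M, TangentSpace 𝓘(ℝ, E) x} (hX : MDiffAt (T% X) x) (hZ : MDiffAt (T% Z) x) :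
    ⟪nabla Y x (X x), Z x⟫ = koszul X Y Z x := by
  have h : ⟪nabla Y x (X x), Z x⟫ = koszulForm Y x hY (X x) (Z x) := by
    rw [nabla, dif_pos hY]
    exact sharp_inner _ _
  rw [h]
  exact TensorialAt.mkHom₂_apply (I := 𝓘(ℝ, E)) (F := E) (F' := E)
    (Φ := fun X Z ↦ koszul X Y Z x) _ _ hX hZ

/-- The Levi-Civita connection of the Riemannian metric, as a covariant derivative on the
tangent bundle; `leviCivita Y x u` is `∇_u Y` at `x`. -/
def leviCivita :
    CovariantDerivative 𝓘(ℝ, E) E (fun x : M ↦ TangentSpace 𝓘(ℝ, E) x) where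
  toFun := nabla
  isCovariantDerivativeOnUniv :=
    { add := by
        intro Y Y' x hY hY' _
        have hs : MDiffAt (T% (Y + Y')) x := mdifferentiableAt_add_section hY hY'
        ext1 u
        refine eq_of_inner_eq fun w ↦ ?_
        have hu := FiberBundle.mdifferentiableAt_extend 𝓘(ℝ, E) E u
        have hw := FiberBundle.mdifferentiableAt_extend 𝓘(ℝ, E) E w
        have h1 := inner_nabla hs hu hw
        have h2 := inner_nabla hY hu hw
        have h3 := inner_nabla hY' hu hw
        rw [koszul_add hu hY hY' hw] at h1
        simp only [FiberBundle.extend_apply_self] at h1 h2 h3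
        rw [h1, _root_.add_apply, inner_add_left, h2, h3]
      leibniz := by
        intro Y f x hY hf _
        have hs : MDiffAt (T% (f • Y)) x := hf.smul_section hY
        ext1 u
        refine eq_of_inner_eq fun w ↦ ?_
        have hu := FiberBundle.mdifferentiableAt_extend 𝓘(ℝ, E) E u
        have hw := FiberBundle.mdifferentiableAt_extend 𝓘(ℝ, E) E w
        have h1 := inner_nabla hs hu hw
        have h2 := inner_nabla hY hu hw
        rw [koszul_leibniz hu hY hw hf] at h1
        simp only [FiberBundle.extend_apply_self] at h1 h2
        rw [h1, _root_.add_apply, inner_add_left, _root_.smul_apply,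
          inner_smul_left, h2, ContinuousLinearMap.smulRight_apply, inner_smul_left]
        rfl }

/-- The Levi-Civita connection is torsion free. -/
theorem leviCivita_torsion_free {X Y : Π x : M, TangentSpace 𝓘(ℝ, E) x} {x : M}
    (hX : MDiffAt (T% X) x) (hY : MDiffAt (T% Y) x) :
    leviCivita Y x (X x) - leviCivita X x (Y x) = mlieBracket 𝓘(ℝ, E) X Y x := by
  refine eq_of_inner_eq fun w ↦ ?_
  have hw := FiberBundle.mdifferentiableAt_extend 𝓘(ℝ, E) E w
  have h1 := inner_nabla hY hX hw
  have h2 := inner_nabla hX hY hw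
  have hc : (fun y ↦ ⟪Y y, X y⟫) = fun y ↦ ⟪X y, Y y⟫ := funext fun y ↦ real_inner_comm _ _
  simp only [FiberBundle.extend_apply_self, koszul, hc, mlieBracket_swap_apply (V := Y) (W := X),
    inner_neg_left] at h1 h2
  change ⟪nabla Y x (X x) - nabla X x (Y x), w⟫ = _
  rw [inner_sub_left, h1, h2]
  ring

/-- The Levi-Civita connection is compatible with the metric. -/
theorem leviCivita_metric {X Y Z : Π x : M, TangentSpace 𝓘(ℝ, E) x} {x : M}
    (hX : MDiffAt (T% X) x) (hY : MDiffAt (T% Y) x) (hZ : MDiffAt (T% Z) x) :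
    d% (fun y ↦ ⟪Y y, Z y⟫) x (X x) =
      ⟪leviCivita Y x (X x), Z x⟫ + ⟪Y x, leviCivita Z x (X x)⟫ := by
  have h1 := inner_nabla hY hX hZ
  have h2 := inner_nabla hZ hX hY
  have hc : (fun y ↦ ⟪Z y, Y y⟫) = fun y ↦ ⟪Y y, Z y⟫ := funext fun y ↦ real_inner_comm _ _
  change _ = ⟪nabla Y x (X x), Z x⟫ + ⟪Y x, nabla Z x (X x)⟫
  rw [real_inner_comm (nabla Z x (X x)) (Y x), h1, h2]
  simp only [koszul, hc, mlieBracket_swap_apply (V := Z) (W := Y), inner_neg_left]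
  ring

/-! ### Curvature, Hessian, Lie derivatives -/

/-- The curvature `R(u, v)w = ∇_U ∇_V W - ∇_V ∇_U W - ∇_[U,V] W` at `x`, computed with the local
extensions `U`, `V`, `W` of `u`, `v`, `w` that are constant in the tangent bundle chart at `x`
(they are smooth near `x`, and the value does not depend on the extensions). -/
def curvature (x : M) (u v w : TangentSpace 𝓘(ℝ, E) x) : TangentSpace 𝓘(ℝ, E) x :=
  let U : Π y : M, TangentSpace 𝓘(ℝ, E) y := FiberBundle.extend E u
  let V : Π y : M, TangentSpace 𝓘(ℝ, E) y := FiberBundle.extend E v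
  let W : Π y : M, TangentSpace 𝓘(ℝ, E) y := FiberBundle.extend E w
  leviCivita (fun y ↦ leviCivita W y (V y)) x u
    - leviCivita (fun y ↦ leviCivita W y (U y)) x v
    - leviCivita W x (mlieBracket 𝓘(ℝ, E) U V x)

/-- The Ricci tensor: `Ric(v, w)` is the trace of `u ↦ R(u, v)w`, computed in an orthonormal
basis of the tangent space. -/
def ricci (x : M) (v w : TangentSpace 𝓘(ℝ, E) x) : ℝ :=
  ∑ i, ⟪curvature x (stdOrthonormalBasis ℝ (TangentSpace 𝓘(ℝ, E) x) i) v w,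
    stdOrthonormalBasis ℝ (TangentSpace 𝓘(ℝ, E) x) i⟫

/-- The gradient vector field. -/
def grad (τ : M → ℝ) (x : M) : TangentSpace 𝓘(ℝ, E) x :=
  sharp (d% τ x)

/-- The Hessian `∇dτ` as a bilinear form, `(∇dτ)(u, w) = g(∇_u ∇τ, w)`. -/
def hessian (τ : M → ℝ) (x : M) (u w : TangentSpace 𝓘(ℝ, E) x) : ℝ :=
  ⟪leviCivita (grad τ) x u, w⟫

/-- The Lie derivative of the metric, `(L_V g)(Y, Z) = V(g(Y, Z)) - g([V, Y], Z) - g(Y, [V, Z])`,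
at `x`. -/
def lieDerivMetric (V Y Z : Π x : M, TangentSpace 𝓘(ℝ, E) x) (x : M) : ℝ :=
  d% (fun y ↦ ⟪Y y, Z y⟫) x (V x) - ⟪mlieBracket 𝓘(ℝ, E) V Y x, Z x⟫
    - ⟪Y x, mlieBracket 𝓘(ℝ, E) V Z x⟫

/-- The Lie derivative `(L_V J)Y = [V, JY] - J[V, Y]` of a field of endomorphisms, at `x`. -/
def lieDerivEndo (J : Π x : M, TangentSpace 𝓘(ℝ, E) x →L[ℝ] TangentSpace 𝓘(ℝ, E) x)
    (V Y : Π x : M, TangentSpace 𝓘(ℝ, E) x) (x : M) : TangentSpace 𝓘(ℝ, E) x :=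
  mlieBracket 𝓘(ℝ, E) V (fun y ↦ J y (Y y)) x - J x (mlieBracket 𝓘(ℝ, E) V Y x)

/-- A Killing vector field: a smooth field `X` with `L_X g = 0`. -/
def IsKilling (X : Π x : M, TangentSpace 𝓘(ℝ, E) x) : Prop :=
  CMDiff ∞ (T% X) ∧
    ∀ (x : M) (Y Z : Π x : M, TangentSpace 𝓘(ℝ, E) x), MDiffAt (T% Y) x → MDiffAt (T% Z) x →
      lieDerivMetric X Y Z x = 0

/-! ### Kähler manifolds and special Kähler potentials -/

/-- `J` makes the given Riemannian manifold a Kähler manifold: it is a smooth orthogonal almost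
complex structure that is parallel for the Levi-Civita connection. -/
structure IsKahler (J : Π x : M, TangentSpace 𝓘(ℝ, E) x →L[ℝ] TangentSpace 𝓘(ℝ, E) x) :
    Prop where
  smooth : ContMDiff 𝓘(ℝ, E) (𝓘(ℝ, E).prod 𝓘(ℝ, E →L[ℝ] E)) ∞
    (fun x ↦ (⟨x, J x⟩ : TotalSpace (E →L[ℝ] E)
      (fun x : M ↦ TangentSpace 𝓘(ℝ, E) x →L[ℝ] TangentSpace 𝓘(ℝ, E) x)))
  sq_eq_neg : ∀ (x : M) (v : TangentSpace 𝓘(ℝ, E) x), J x (J x v) = -v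
  inner_map_map : ∀ (x : M) (v w : TangentSpace 𝓘(ℝ, E) x), ⟪J x v, J x w⟫ = ⟪v, w⟫
  parallel : ∀ (x : M) (Y : Π x : M, TangentSpace 𝓘(ℝ, E) x), MDiffAt (T% Y) x →
    ∀ u : TangentSpace 𝓘(ℝ, E) x,
      leviCivita (fun y ↦ J y (Y y)) x u = J x (leviCivita Y x u)

/-- A special Kähler potential: a nonconstant smooth function `τ` for which `X = J∇τ` is a Killing
field and, wherever `dτ ≠ 0`, all nonzero vectors orthogonal to `X` and `JX` are eigenvectors
of `∇dτ`. -/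
structure IsSpecialKahlerPotential
    (J : Π x : M, TangentSpace 𝓘(ℝ, E) x →L[ℝ] TangentSpace 𝓘(ℝ, E) x) (τ : M → ℝ) : Prop where
  smooth : CMDiff ∞ τ
  nonconstant : ¬ ∃ c : ℝ, ∀ x, τ x = c
  killing : IsKilling (fun x ↦ J x (grad τ x))
  eigenvector : ∀ x : M, d% τ x ≠ 0 → ∀ w : TangentSpace 𝓘(ℝ, E) x, w ≠ 0 →
    ⟪J x (grad τ x), w⟫ = 0 → ⟪J x (J x (grad τ x)), w⟫ = 0 →
      ∃ μ : ℝ, ∀ u : TangentSpace 𝓘(ℝ, E) x, hessian τ x w u = μ * ⟪w, u⟫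

/-! ### Foliations, given by their tangent distributions -/

/-- `V` is a smooth section over `W` of the distribution `D`. -/
def IsSectionOn (D : Π x : M, Submodule ℝ (TangentSpace 𝓘(ℝ, E) x)) (W : Set M)
    (V : Π x : M, TangentSpace 𝓘(ℝ, E) x) : Prop :=
  CMDiff[W] ∞ (T% V) ∧ ∀ x ∈ W, V x ∈ D x

/-- On the open set `U`, `D` is (the tangent distribution of) a complex foliation by curves: a
smooth, involutive, `J`-invariant distribution of real rank two. -/
structure IsComplexFoliationByCurves
    (J : Π x : M, TangentSpace 𝓘(ℝ, E) x →L[ℝ] TangentSpace 𝓘(ℝ, E) x)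
    (D : Π x : M, Submodule ℝ (TangentSpace 𝓘(ℝ, E) x)) (U : Set M) : Prop where
  isOpen : IsOpen U
  rank_two : ∀ x ∈ U, Module.finrank ℝ (D x) = 2
  smooth : ∀ x ∈ U, ∃ W : Set M, IsOpen W ∧ x ∈ W ∧ W ⊆ U ∧
    ∃ V₁ V₂ : Π x : M, TangentSpace 𝓘(ℝ, E) x, IsSectionOn D W V₁ ∧ IsSectionOn D W V₂ ∧
      ∀ y ∈ W, D y = Submodule.span ℝ {V₁ y, V₂ y}
  involutive : ∀ W : Set M, IsOpen W → W ⊆ U → ∀ V V' : Π x : M, TangentSpace 𝓘(ℝ, E) x,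
    IsSectionOn D W V → IsSectionOn D W V' → ∀ x ∈ W, mlieBracket 𝓘(ℝ, E) V V' x ∈ D x
  complex : ∀ x ∈ U, (D x).map (J x).toLinearMap = D x

/-- The leaves are totally geodesic: `∇_V V'` is tangent to the foliation whenever `V` and `V'`
are. -/
def IsTotallyGeodesic (D : Π x : M, Submodule ℝ (TangentSpace 𝓘(ℝ, E) x)) (U : Set M) : Prop :=
  ∀ W : Set M, IsOpen W → W ⊆ U → ∀ V V' : Π x : M, TangentSpace 𝓘(ℝ, E) x,
    IsSectionOn D W V → IsSectionOn D W V' → ∀ x ∈ W, leviCivita V' x (V x) ∈ D x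

/-- The foliation is holomorphic: `(L_V J)(TM) ⊆ D` for all local sections `V` of `D`. -/
def IsHolomorphic (J : Π x : M, TangentSpace 𝓘(ℝ, E) x →L[ℝ] TangentSpace 𝓘(ℝ, E) x)
    (D : Π x : M, Submodule ℝ (TangentSpace 𝓘(ℝ, E) x)) (U : Set M) : Prop :=
  ∀ W : Set M, IsOpen W → W ⊆ U → ∀ V Y : Π x : M, TangentSpace 𝓘(ℝ, E) x,
    IsSectionOn D W V → CMDiff[W] ∞ (T% Y) → ∀ x ∈ W, lieDerivEndo J V Y x ∈ D x

/-- A smooth one-form on the open set `U`: it maps smooth local vector fields to smooth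
functions. -/
def IsSmoothOneFormOn (α : Π x : M, TangentSpace 𝓘(ℝ, E) x →L[ℝ] ℝ) (U : Set M) : Prop :=
  ∀ W : Set M, IsOpen W → W ⊆ U → ∀ Y : Π x : M, TangentSpace 𝓘(ℝ, E) x,
    CMDiff[W] ∞ (T% Y) → CMDiff[W] ∞ (fun x ↦ α x (Y x))

/-- `dα = 0` on the open set `U`, where `dα(Y, Z) = Y(α(Z)) - Z(α(Y)) - α([Y, Z])`. -/
def IsClosedOneFormOn (α : Π x : M, TangentSpace 𝓘(ℝ, E) x →L[ℝ] ℝ) (U : Set M) : Prop :=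
  ∀ W : Set M, IsOpen W → W ⊆ U → ∀ Y Z : Π x : M, TangentSpace 𝓘(ℝ, E) x,
    CMDiff[W] ∞ (T% Y) → CMDiff[W] ∞ (T% Z) → ∀ x ∈ W,
      d% (fun y ↦ α y (Z y)) x (Y x) - d% (fun y ↦ α y (Y y)) x (Z x)
        - α x (mlieBracket 𝓘(ℝ, E) Y Z x) = 0

/-- The foliation is conformal on `U` with one-form `α`: `α` vanishes on the orthogonal complement
of `D`, and `L_V g = α(V) g` on that complement for all local sections `V` of `D`. -/
def IsConformalWith (D : Π x : M, Submodule ℝ (TangentSpace 𝓘(ℝ, E) x)) (U : Set M)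
    (α : Π x : M, TangentSpace 𝓘(ℝ, E) x →L[ℝ] ℝ) : Prop :=
  IsSmoothOneFormOn α U ∧ (∀ x ∈ U, ∀ w ∈ (D x)ᗮ, α x w = 0) ∧
    ∀ W : Set M, IsOpen W → W ⊆ U → ∀ V : Π x : M, TangentSpace 𝓘(ℝ, E) x, IsSectionOn D W V →
      ∀ x ∈ W, ∀ Y Z : Π x : M, TangentSpace 𝓘(ℝ, E) x, MDiffAt (T% Y) x → MDiffAt (T% Z) x →
        Y x ∈ (D x)ᗮ → Z x ∈ (D x)ᗮ → lieDerivMetric V Y Z x = α x (V x) * ⟪Y x, Z x⟫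

/-- The foliation is homothetic: conformal with a closed one-form. -/
def IsHomothetic (D : Π x : M, Submodule ℝ (TangentSpace 𝓘(ℝ, E) x)) (U : Set M) : Prop :=
  ∃ α : Π x : M, TangentSpace 𝓘(ℝ, E) x →L[ℝ] ℝ, IsConformalWith D U α ∧ IsClosedOneFormOn α U

/-- The distribution `span{∇τ, J∇τ}`. -/
def potentialDistribution
    (J : Π x : M, TangentSpace 𝓘(ℝ, E) x →L[ℝ] TangentSpace 𝓘(ℝ, E) x) (τ : M → ℝ) (x : M) :
    Submodule ℝ (TangentSpace 𝓘(ℝ, E) x) :=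
  Submodule.span ℝ {grad τ x, J x (grad τ x)}

end

end KahlerFoliation

namespace KahlerFoliation

noncomputable section

variable
  {E : Type*} [NormedAddCommGroup E] [NormedSpace ℝ E] [FiniteDimensional ℝ E]
  {M : Type*} [TopologicalSpace M] [ChartedSpace E M] [IsManifold 𝓘(ℝ, E) ∞ M]
  [RiemannianBundle (fun x : M ↦ TangentSpace 𝓘(ℝ, E) x)]
  [IsContMDiffRiemannianBundle 𝓘(ℝ, E) ∞ E (fun x : M ↦ TangentSpace 𝓘(ℝ, E) x)]

/-! Write T = ∇τ, X = JT, Q = g(T, T), 𝒱 = span{T, X}, and let S = ∇T be the Hessian endomorphism. S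
is symmetric, and since X is Killing it commutes with J. On U it acts on 𝒱 as a scalar ψ
(`gradEigenvalue`) and on 𝒱^⊥ as a scalar φ (`transverseEigenvalue`), so S = φ·1 + σ(T♭⊗T + X♭⊗X)
with σ = (ψ - φ)/Q (`leviCivita_grad_eq`). Both conditions turn out to say that dφ is pointwise a
multiple of dτ.

Ricci side: ∇X = JS, and Kostant's formula (`IsKilling.second_derivative`) identifies R(u, X) with
∇_u(JS). Putting u = X gives Xφ = Xσ = 0. Taking the trace gives Ric(X, w) = dφ(Jw) + κ g(X, w).
Hence X is a Ricci eigenvector exactly when dφ is a multiple of dτ (`ricci_eigenvector_iff`).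

Foliation side: for a section V = fT + hX of 𝒱, modulo 𝒱 one has ∇_u V ≡ φ(fu + hJu)
(`exists_leviCivita_sub_mem`). This makes 𝒱 totally geodesic, involutive, holomorphic and conformal,
whatever the Ricci tensor is, with one-form α = (2φ/Q) dτ. If 𝒱^⊥ ≠ 0, this α is the only possible
one. Since dQ = 2ψ dτ, closedness of α amounts to dφ ∧ dτ = 0.

In real dimension two 𝒱^⊥ vanishes and φ is set to ψ. Then σ = 0, and Xφ = 0 already forces dφ to be
a multiple of dτ, so both conditions hold. -/

theorem two_le_infty : (2 : ℕ∞ω) ≤ ∞ := WithTop.coe_le_coe.2 (le_top (a := (2 : ℕ∞)))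

theorem three_le_infty : (3 : ℕ∞ω) ≤ ∞ := WithTop.coe_le_coe.2 (le_top (a := (3 : ℕ∞)))

/-! ### Smoothness of vector fields tested through the metric -/

theorem contMDiffAt_matrix_det {ι : Type*} [Fintype ι] [DecidableEq ι]
    {G : M → Matrix ι ι ℝ} {x : M} (hG : ∀ i j, CMDiffAt ∞ (fun y ↦ G y i j) x) :
    CMDiffAt ∞ (fun y ↦ (G y).det) x := by
  simp only [Matrix.det_apply']
  refine contMDiffAt_finsetSum fun σ _ ↦ ?_
  have h : CMDiffAt ∞ (fun y ↦ ∏ i, G y (σ i) i) x := contMDiffAt_finsetProd fun i _ ↦ hG _ _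
  exact contMDiffAt_const.mul h

/-- A vector field is smooth as soon as its inner products with smooth fields are. -/
theorem contMDiffAt_of_inner_extend {V : Π x : M, TangentSpace 𝓘(ℝ, E) x} {x : M}
    (h : ∀ W : Π x : M, TangentSpace 𝓘(ℝ, E) x, CMDiffAt ∞ (T% W) x →
      CMDiffAt ∞ (fun y ↦ ⟪V y, W y⟫) x) : CMDiffAt ∞ (T% V) x := by
  classical
  let t := trivializationAt E (fun x : M ↦ TangentSpace 𝓘(ℝ, E) x) x
  have hx : x ∈ t.baseSet := FiberBundle.mem_baseSet_trivializationAt' x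
  let b := Module.finBasis ℝ E
  let e := t.localFrame b
  have he : ∀ i, CMDiffAt ∞ (T% (e i)) x := fun i ↦ contMDiffAt_localFrame_of_mem ∞ t b i hx
  -- The coefficients of `V` in a local frame solve a linear system with the Gram matrix `G` and
  -- right-hand side `β`. Cramer's rule writes them as quotients of smooth determinants.
  let G : M → Matrix (Fin (Module.finrank ℝ E)) (Fin (Module.finrank ℝ E)) ℝ :=
    fun y ↦ Matrix.of fun i j ↦ ⟪e j y, e i y⟫
  let β : M → Fin (Module.finrank ℝ E) → ℝ := fun y i ↦ ⟪V y, e i y⟫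
  have hG : ∀ i j, CMDiffAt ∞ (fun y ↦ G y i j) x := fun i j ↦
    ContMDiffAt.inner_bundle (E := fun x : M ↦ TangentSpace 𝓘(ℝ, E) x) (b := fun x ↦ x)
      (he j) (he i)
  have hβ : ∀ i, CMDiffAt ∞ (fun y ↦ β y i) x := fun i ↦ h _ (he i)
  have hframe := t.isLocalFrameOn_localFrame_baseSet 𝓘(ℝ, E) ∞ b
  have hdet : ∀ y ∈ t.baseSet, (G y).det ≠ 0 := by
    intro y hy hdet
    -- A kernel vector of the Gram matrix gives a combination of frame vectors of length zero.
    obtain ⟨c, hc, hc0⟩ := Matrix.exists_mulVec_eq_zero_iff.2 hdet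
    have hs : ∑ j, c j • e j y = 0 := by
      rw [← inner_self_eq_zero (𝕜 := ℝ)]
      rw [inner_sum]
      refine Finset.sum_eq_zero fun i _ ↦ ?_
      rw [inner_smul_right, sum_inner]
      have := congrFun hc0 i
      simp only [Matrix.mulVec, dotProduct, G, Matrix.of_apply, Pi.zero_apply] at this
      simp only [inner_smul_left]
      rw [show (∑ j, (starRingEnd ℝ) (c j) * ⟪e j y, e i y⟫) = 0 by
        rw [← this]; exact Finset.sum_congr rfl fun j _ ↦ mul_comm _ _, mul_zero]
    exact hc (funext (Fintype.linearIndependent_iff.1 (hframe.linearIndependent hy) c hs))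
  let c : M → Fin (Module.finrank ℝ E) → ℝ :=
    fun y i ↦ ((G y).updateCol i (β y)).det / (G y).det
  have hc : ∀ i, CMDiffAt ∞ (fun y ↦ c y i) x := by
    intro i
    refine ContMDiffAt.div₀ (contMDiffAt_matrix_det fun k l ↦ ?_) (contMDiffAt_matrix_det hG)
      (hdet x hx)
    by_cases hl : l = i
    · subst hl; simpa using hβ k
    · simpa [Matrix.updateCol_apply, hl] using hG k l
  have hsum : CMDiffAt ∞ (T% (fun y ↦ ∑ i, c y i • e i y)) x :=
    .sum_section fun i _ ↦ (hc i).smul_section (he i)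
  refine hsum.congr_of_eventuallyEq ?_
  filter_upwards [t.open_baseSet.mem_nhds hx] with y hy
  have hV := hframe.coeff_sum_eq V hy
  set a : Fin (Module.finrank ℝ E) → ℝ := fun i ↦ hframe.coeff i y (V y) with ha
  have hβa : β y = (G y).mulVec a := by
    ext i
    simp only [β, Matrix.mulVec, dotProduct, G, Matrix.of_apply]
    rw [hV, sum_inner]
    simp only [inner_smul_left]
    exact Finset.sum_congr rfl fun j _ ↦ mul_comm _ _
  have hca : c y = a := by
    ext i
    have h1 := congrFun (Matrix.cramer_eq_adjugate_mulVec (G y) (β y)) i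
    rw [hβa, Matrix.mulVec_mulVec, Matrix.adjugate_mul, Matrix.smul_mulVec, Matrix.one_mulVec,
      Matrix.cramer_apply] at h1
    simp only [c]
    rw [hβa, h1, Pi.smul_apply, smul_eq_mul, mul_div_cancel_left₀ _ (hdet y hy)]
  simp only [hca]
  exact congrArg _ hV

theorem contMDiffAt_inner {V W : Π x : M, TangentSpace 𝓘(ℝ, E) x} {x : M}
    (hV : CMDiffAt ∞ (T% V) x) (hW : CMDiffAt ∞ (T% W) x) :
    CMDiffAt ∞ (fun y ↦ ⟪V y, W y⟫) x :=
  ContMDiffAt.inner_bundle (E := fun x : M ↦ TangentSpace 𝓘(ℝ, E) x) (b := fun x ↦ x) hV hW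

theorem contMDiffAt_extend_vector {x : M} (v : TangentSpace 𝓘(ℝ, E) x) :
    CMDiffAt ∞ (T% (FiberBundle.extend E v : Π y : M, TangentSpace 𝓘(ℝ, E) y)) x :=
  FiberBundle.contMDiffAt_extend 𝓘(ℝ, E) E v

theorem mdiffAt_of_contMDiffAt {V : Π x : M, TangentSpace 𝓘(ℝ, E) x} {x : M}
    (hV : CMDiffAt ∞ (T% V) x) : MDiffAt (T% V) x :=
  hV.mdifferentiableAt (by simp)

theorem eventually_mdiffAt {V : Π x : M, TangentSpace 𝓘(ℝ, E) x} {x : M}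
    (hV : CMDiffAt ∞ (T% V) x) : ∀ᶠ y in 𝓝 x, MDiffAt (T% V) y := by
  have h := (contMDiffAt_iff_contMDiffAt_nhds (n := 1) (by simp)).1 (hV.of_le (by simp))
  exact h.mono fun y hy ↦ hy.mdifferentiableAt one_ne_zero

theorem eventually_mdiffAt_fun {f : M → ℝ} {x : M}
    (hf : CMDiffAt ∞ f x) : ∀ᶠ y in 𝓝 x, MDiffAt f y := by
  have h := (contMDiffAt_iff_contMDiffAt_nhds (n := 1) (by simp)).1 (hf.of_le (by simp))
  exact h.mono fun y hy ↦ hy.mdifferentiableAt one_ne_zero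

theorem contMDiffAt_mlieBracket {V W : Π x : M, TangentSpace 𝓘(ℝ, E) x} {x : M}
    (hV : CMDiffAt ∞ (T% V) x) (hW : CMDiffAt ∞ (T% W) x) :
    CMDiffAt ∞ (T% (mlieBracket 𝓘(ℝ, E) V W)) x :=
  have : IsManifold 𝓘(ℝ, E) (((⊤ : ℕ∞) : ℕ∞ω) + 1) M := by simpa
  have : IsManifold 𝓘(ℝ, E) (minSmoothness ℝ 2) M :=
    IsManifold.of_le (n := ∞) (by simpa using two_le_infty)
  ContMDiffAt.mlieBracket_vectorField (m := ⊤) (n := ⊤) hV hW (by simp)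

/-! ### Derivatives of functions, extracted from Lie brackets -/

theorem exists_contMDiffAt_ne_zero [Nontrivial E] (x : M) :
    ∃ Z : Π y : M, TangentSpace 𝓘(ℝ, E) y, CMDiffAt ∞ (T% Z) x ∧ Z x ≠ 0 := by
  have : Nontrivial (TangentSpace 𝓘(ℝ, E) x) := inferInstanceAs (Nontrivial E)
  obtain ⟨z, hz⟩ := exists_ne (0 : TangentSpace 𝓘(ℝ, E) x)
  exact ⟨FiberBundle.extend E z, contMDiffAt_extend_vector z, by
    rwa [FiberBundle.extend_apply_self]⟩

/-- The derivative of a smooth function along a smooth vector field is smooth. -/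
theorem contMDiffAt_mvfderiv {f : M → ℝ} {V : Π x : M, TangentSpace 𝓘(ℝ, E) x} {x : M}
    (hf : CMDiffAt ∞ f x) (hV : CMDiffAt ∞ (T% V) x) :
    CMDiffAt ∞ (fun y ↦ d% f y (V y)) x := by
  rcases subsingleton_or_nontrivial E with hE | hE
  · have : (fun y ↦ d% f y (V y)) = fun _ ↦ 0 := by
      ext y
      have : V y = 0 := Subsingleton.elim (α := E) _ _
      simp [this]
    rw [this]
    exact contMDiffAt_const
  obtain ⟨Z, hZ, hZx⟩ := exists_contMDiffAt_ne_zero (E := E) x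
  -- The Leibniz rule gives [V, fZ] - f[V, Z] = (Vf) Z. Pairing with Z and dividing by g(Z, Z)
  -- recovers Vf from smooth fields.
  have h1 : CMDiffAt ∞ (T% (mlieBracket 𝓘(ℝ, E) V (f • Z) - f • mlieBracket 𝓘(ℝ, E) V Z)) x :=
    (contMDiffAt_mlieBracket hV (hf.smul_section hZ)).sub_section
      (hf.smul_section (contMDiffAt_mlieBracket hV hZ))
  have h2 := (contMDiffAt_inner h1 hZ).div₀ (contMDiffAt_inner hZ hZ)
    (by simpa using hZx)
  refine h2.congr_of_eventuallyEq ?_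
  have hne : ∀ᶠ y in 𝓝 x, ⟪Z y, Z y⟫ ≠ 0 :=
    (contMDiffAt_inner hZ hZ).continuousAt.eventually_ne (by simpa using hZx)
  filter_upwards [eventually_mdiffAt hZ, eventually_mdiffAt_fun hf, hne] with y hy hfy hney
  rw [Pi.div_apply, eq_div_iff hney]
  simp only [Pi.sub_apply, Pi.smul_apply']
  rw [mlieBracket_smul_right hfy hy, add_sub_cancel_right, inner_smul_left]
  simp

/-- The commutator of two vector fields, acting on functions, is their Lie bracket. -/
theorem mvfderiv_mvfderiv_sub {f : M → ℝ} {V W : Π x : M, TangentSpace 𝓘(ℝ, E) x} {x : M}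
    (hf : CMDiffAt ∞ f x) (hV : CMDiffAt ∞ (T% V) x) (hW : CMDiffAt ∞ (T% W) x) :
    d% (fun y ↦ d% f y (W y)) x (V x) - d% (fun y ↦ d% f y (V y)) x (W x) =
      d% f x (mlieBracket 𝓘(ℝ, E) V W x) := by
  rcases subsingleton_or_nontrivial E with hE | hE
  · have h0 : ∀ v : TangentSpace 𝓘(ℝ, E) x, v = 0 := fun v ↦ Subsingleton.elim (α := E) _ _
    rw [h0 (V x), h0 (W x), h0 (mlieBracket 𝓘(ℝ, E) V W x)]
    simp
  obtain ⟨Z, hZ, hZx⟩ := exists_contMDiffAt_ne_zero (E := E) x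
  have jacobi : ∀ Y : Π x : M, TangentSpace 𝓘(ℝ, E) x, CMDiffAt ∞ (T% Y) x →
      mlieBracket 𝓘(ℝ, E) V (mlieBracket 𝓘(ℝ, E) W Y) x =
        mlieBracket 𝓘(ℝ, E) (mlieBracket 𝓘(ℝ, E) V W) Y x
          + mlieBracket 𝓘(ℝ, E) W (mlieBracket 𝓘(ℝ, E) V Y) x := by
    intro Y hY
    have : IsManifold 𝓘(ℝ, E) (minSmoothness ℝ 3) M :=
      IsManifold.of_le (n := ∞) (by simpa using three_le_infty)
    have h2 : minSmoothness ℝ 2 ≤ ∞ := by simpa using two_le_infty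
    exact leibniz_identity_mlieBracket_apply (hV.of_le h2) (hW.of_le h2) (hY.of_le h2)
  have expand : ∀ A B : Π x : M, TangentSpace 𝓘(ℝ, E) x, CMDiffAt ∞ (T% A) x →
      CMDiffAt ∞ (T% B) x →
      mlieBracket 𝓘(ℝ, E) A (mlieBracket 𝓘(ℝ, E) B (f • Z)) x =
        d% (fun y ↦ d% f y (B y)) x (A x) • Z x + d% f x (B x) • mlieBracket 𝓘(ℝ, E) A Z x
        + d% f x (A x) • mlieBracket 𝓘(ℝ, E) B Z x
        + f x • mlieBracket 𝓘(ℝ, E) A (mlieBracket 𝓘(ℝ, E) B Z) x := by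
    intro A B hA hB
    have he : mlieBracket 𝓘(ℝ, E) B (f • Z) =ᶠ[𝓝 x]
        (fun y ↦ d% f y (B y)) • Z + f • mlieBracket 𝓘(ℝ, E) B Z := by
      filter_upwards [eventually_mdiffAt hZ, eventually_mdiffAt_fun hf] with y hy hfy
      rw [mlieBracket_smul_right hfy hy]
      rfl
    have hdf := contMDiffAt_mvfderiv hf hB
    have hBZ := contMDiffAt_mlieBracket hB hZ
    rw [Filter.EventuallyEq.mlieBracket_vectorField_eq (Filter.EventuallyEq.refl _ A) he,
      mlieBracket_add_right (mdiffAt_of_contMDiffAt (hdf.smul_section hZ))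
        (mdiffAt_of_contMDiffAt (hf.smul_section hBZ)),
      mlieBracket_smul_right (hdf.mdifferentiableAt (by simp)) (mdiffAt_of_contMDiffAt hZ),
      mlieBracket_smul_right (hf.mdifferentiableAt (by simp)) (mdiffAt_of_contMDiffAt hBZ)]
    abel
  -- In the Jacobi identity for V, W and fZ, the terms with derivatives of Z cancel, and what is
  -- left is a multiple of Z, which is nonzero at `x`.
  have h := jacobi (f • Z) (hf.smul_section hZ)
  rw [expand V W hV hW, expand W V hW hV, jacobi Z hZ,
    mlieBracket_smul_right (hf.mdifferentiableAt (by simp)) (mdiffAt_of_contMDiffAt hZ)] at h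
  have h' : (d% (fun y ↦ d% f y (W y)) x (V x) - d% (fun y ↦ d% f y (V y)) x (W x) -
      d% f x (mlieBracket 𝓘(ℝ, E) V W x)) • Z x = 0 := by
    rw [← sub_eq_zero] at h
    rw [← h]
    module
  have := (smul_eq_zero.1 h').resolve_right hZx
  linarith

/-! ### Calculus of the Levi-Civita connection -/

theorem mvfderiv_congr {f g : M → ℝ} {x : M} (h : f =ᶠ[𝓝 x] g) : d% f x = d% g x := by
  ext v
  have h' := h.mfderiv_eq (I := 𝓘(ℝ, E)) (I' := 𝓘(ℝ, ℝ))
  simp only [mvfderiv, h']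
  rfl

theorem leviCivita_congr {Y Y' : Π x : M, TangentSpace 𝓘(ℝ, E) x} {x : M}
    (hY : MDiffAt (T% Y) x) (h : Y =ᶠ[𝓝 x] Y') : leviCivita Y x = leviCivita Y' x := by
  have hY' : MDiffAt (T% Y') x := by
    refine hY.congr_of_eventuallyEq ?_
    filter_upwards [h] with y hy
    rw [hy]
  exact leviCivita.isCovariantDerivativeOnUniv.congr_of_eventuallyEq hY hY' Filter.univ_mem h

theorem leviCivita_add {Y Y' : Π x : M, TangentSpace 𝓘(ℝ, E) x} {x : M}
    (hY : MDiffAt (T% Y) x) (hY' : MDiffAt (T% Y') x) :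
    leviCivita (Y + Y') x = leviCivita Y x + leviCivita Y' x :=
  leviCivita.isCovariantDerivativeOnUniv.add hY hY'

theorem leviCivita_smul {Y : Π x : M, TangentSpace 𝓘(ℝ, E) x} {f : M → ℝ} {x : M}
    (hf : MDiffAt f x) (hY : MDiffAt (T% Y) x) (u : TangentSpace 𝓘(ℝ, E) x) :
    leviCivita (f • Y) x u = f x • leviCivita Y x u + d% f x u • Y x := by
  rw [leviCivita.isCovariantDerivativeOnUniv.leibniz hY hf]
  rfl

theorem leviCivita_metric_apply {Y Z : Π x : M, TangentSpace 𝓘(ℝ, E) x} {x : M}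
    (hY : MDiffAt (T% Y) x) (hZ : MDiffAt (T% Z) x) (u : TangentSpace 𝓘(ℝ, E) x) :
    d% (fun y ↦ ⟪Y y, Z y⟫) x u = ⟪leviCivita Y x u, Z x⟫ + ⟪Y x, leviCivita Z x u⟫ := by
  have h := leviCivita_metric (FiberBundle.mdifferentiableAt_extend 𝓘(ℝ, E) E u) hY hZ
  rwa [FiberBundle.extend_apply_self] at h

/-- The covariant derivative of a smooth vector field along a smooth vector field is smooth. -/
theorem contMDiffAt_leviCivita {V Y : Π x : M, TangentSpace 𝓘(ℝ, E) x} {x : M}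
    (hV : CMDiffAt ∞ (T% V) x) (hY : CMDiffAt ∞ (T% Y) x) :
    CMDiffAt ∞ (T% (fun y ↦ leviCivita Y y (V y))) x := by
  refine contMDiffAt_of_inner_extend fun W hW ↦ ?_
  have hk : CMDiffAt ∞ (fun y ↦ koszul V Y W y) x :=
    contMDiffAt_const.mul
      ((((((contMDiffAt_mvfderiv (contMDiffAt_inner hY hW) hV).add
        (contMDiffAt_mvfderiv (contMDiffAt_inner hV hW) hY)).sub
        (contMDiffAt_mvfderiv (contMDiffAt_inner hV hY) hW)).add
        (contMDiffAt_inner (contMDiffAt_mlieBracket hV hY) hW)).sub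
        (contMDiffAt_inner (contMDiffAt_mlieBracket hV hW) hY)).sub
        (contMDiffAt_inner (contMDiffAt_mlieBracket hY hW) hV))
  refine hk.congr_of_eventuallyEq ?_
  filter_upwards [eventually_mdiffAt hV, eventually_mdiffAt hY, eventually_mdiffAt hW]
    with y h1 h2 h3
  exact inner_nabla h2 h1 h3

/-! ### Symmetries of the curvature -/

/-- The curvature operator `∇_U ∇_V W - ∇_V ∇_U W - ∇_[U,V] W` on vector fields. -/
def curvatureField (U V W : Π x : M, TangentSpace 𝓘(ℝ, E) x) (x : M) :
    TangentSpace 𝓘(ℝ, E) x :=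
  leviCivita (fun y ↦ leviCivita W y (V y)) x (U x)
    - leviCivita (fun y ↦ leviCivita W y (U y)) x (V x)
    - leviCivita W x (mlieBracket 𝓘(ℝ, E) U V x)

theorem curvature_eq_curvatureField (x : M) (u v w : TangentSpace 𝓘(ℝ, E) x) :
    curvature x u v w = curvatureField (FiberBundle.extend E u) (FiberBundle.extend E v)
      (FiberBundle.extend E w) x := by
  simp [curvature, curvatureField]

theorem curvatureField_swap (U V W : Π x : M, TangentSpace 𝓘(ℝ, E) x) (x : M) :
    curvatureField U V W x = -curvatureField V U W x := by
  simp only [curvatureField, mlieBracket_swap_apply (V := U) (W := V), map_neg]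
  abel

/-- Differentiate the function g(Z, W) twice by metric compatibility. In the commutator of U and V
the mixed terms cancel, and the rest must equal the derivative along [U, V]. -/
theorem inner_curvatureField_add {U V Z W : Π x : M, TangentSpace 𝓘(ℝ, E) x} {x : M}
    (hU : CMDiffAt ∞ (T% U) x) (hV : CMDiffAt ∞ (T% V) x) (hZ : CMDiffAt ∞ (T% Z) x)
    (hW : CMDiffAt ∞ (T% W) x) :
    ⟪curvatureField U V Z x, W x⟫ + ⟪Z x, curvatureField U V W x⟫ = 0 := by
  have second : ∀ A B : Π x : M, TangentSpace 𝓘(ℝ, E) x, CMDiffAt ∞ (T% B) x →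
      d% (fun y ↦ d% (fun y ↦ ⟪Z y, W y⟫) y (B y)) x (A x) =
        ⟪leviCivita (fun y ↦ leviCivita Z y (B y)) x (A x), W x⟫
          + ⟪leviCivita Z x (B x), leviCivita W x (A x)⟫
          + (⟪leviCivita Z x (A x), leviCivita W x (B x)⟫
          + ⟪Z x, leviCivita (fun y ↦ leviCivita W y (B y)) x (A x)⟫) := by
    intro A B hB
    have h1 := contMDiffAt_leviCivita hB hZ
    have h2 := contMDiffAt_leviCivita hB hW
    have he : (fun y ↦ d% (fun y ↦ ⟪Z y, W y⟫) y (B y)) =ᶠ[𝓝 x]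
        fun y ↦ ⟪leviCivita Z y (B y), W y⟫ + ⟪Z y, leviCivita W y (B y)⟫ := by
      filter_upwards [eventually_mdiffAt hZ, eventually_mdiffAt hW] with y hy hy'
      exact leviCivita_metric_apply hy hy' _
    rw [mvfderiv_congr he, mvfderiv_fun_add
      ((contMDiffAt_inner h1 hW).mdifferentiableAt (by simp))
      ((contMDiffAt_inner hZ h2).mdifferentiableAt (by simp)), _root_.add_apply,
      leviCivita_metric_apply (mdiffAt_of_contMDiffAt h1) (mdiffAt_of_contMDiffAt hW),
      leviCivita_metric_apply (mdiffAt_of_contMDiffAt hZ) (mdiffAt_of_contMDiffAt h2)]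
  have h := mvfderiv_mvfderiv_sub (contMDiffAt_inner hZ hW) hU hV
  rw [second U V hV, second V U hU, leviCivita_metric_apply (mdiffAt_of_contMDiffAt hZ)
    (mdiffAt_of_contMDiffAt hW)] at h
  simp only [curvatureField, inner_sub_left, inner_sub_right]
  linarith

/-- The first Bianchi identity. -/
theorem curvatureField_bianchi {U V W : Π x : M, TangentSpace 𝓘(ℝ, E) x} {x : M}
    (hU : CMDiffAt ∞ (T% U) x) (hV : CMDiffAt ∞ (T% V) x) (hW : CMDiffAt ∞ (T% W) x) :
    curvatureField U V W x + curvatureField V W U x + curvatureField W U V x = 0 := by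
  -- Regrouped by torsion-freeness, the cyclic sum of curvatures consists of three expressions ∇_A
  -- [B, C] - ∇_[B,C] A = [A, [B, C]], so it vanishes by Jacobi.
  have key : ∀ A B C : Π x : M, TangentSpace 𝓘(ℝ, E) x, CMDiffAt ∞ (T% A) x →
      CMDiffAt ∞ (T% B) x → CMDiffAt ∞ (T% C) x →
      leviCivita (fun y ↦ leviCivita C y (B y)) x (A x)
        - leviCivita (fun y ↦ leviCivita B y (C y)) x (A x)
        - leviCivita A x (mlieBracket 𝓘(ℝ, E) B C x) =
      mlieBracket 𝓘(ℝ, E) A (mlieBracket 𝓘(ℝ, E) B C) x := by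
    intro A B C hA hB hC
    have h1 := mdiffAt_of_contMDiffAt (contMDiffAt_leviCivita hC hB)
    have h2 := mdiffAt_of_contMDiffAt (contMDiffAt_mlieBracket hB hC)
    have he : (fun y ↦ leviCivita B y (C y)) + mlieBracket 𝓘(ℝ, E) B C =ᶠ[𝓝 x]
        fun y ↦ leviCivita C y (B y) := by
      filter_upwards [eventually_mdiffAt hB, eventually_mdiffAt hC] with y hy hy'
      simp only [Pi.add_apply]
      rw [← leviCivita_torsion_free hy hy']
      abel
    rw [← leviCivita_congr (mdifferentiableAt_add_section h1 h2) he, leviCivita_add h1 h2,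
      ← leviCivita_torsion_free (mdiffAt_of_contMDiffAt hA) h2]
    simp only [_root_.add_apply]
    abel
  have h : IsManifold 𝓘(ℝ, E) (minSmoothness ℝ 3) M :=
    IsManifold.of_le (n := ∞) (by simpa using three_le_infty)
  have h2 : minSmoothness ℝ 2 ≤ ∞ := by simpa using two_le_infty
  have jac := leibniz_identity_mlieBracket_apply (hU.of_le h2) (hV.of_le h2) (hW.of_le h2)
  have k1 := key U V W hU hV hW
  have k2 := key V W U hV hW hU
  have k3 := key W U V hW hU hV
  rw [mlieBracket_swap_apply (V := mlieBracket 𝓘(ℝ, E) U V) (W := W)] at jac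
  have hs : mlieBracket 𝓘(ℝ, E) V (mlieBracket 𝓘(ℝ, E) W U) x =
      -mlieBracket 𝓘(ℝ, E) V (mlieBracket 𝓘(ℝ, E) U W) x := by
    rw [mlieBracket_swap (V := W) (W := U),
      show -mlieBracket 𝓘(ℝ, E) U W = ((-1 : ℝ) • mlieBracket 𝓘(ℝ, E) U W) by simp,
      mlieBracket_const_smul_right (mdiffAt_of_contMDiffAt (contMDiffAt_mlieBracket hU hW))]
    simp
  have hsum : mlieBracket 𝓘(ℝ, E) U (mlieBracket 𝓘(ℝ, E) V W) x
      + mlieBracket 𝓘(ℝ, E) V (mlieBracket 𝓘(ℝ, E) W U) x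
      + mlieBracket 𝓘(ℝ, E) W (mlieBracket 𝓘(ℝ, E) U V) x = 0 := by
    rw [jac, hs]
    abel
  rw [← k1, ← k2, ← k3] at hsum
  rw [← hsum]
  simp only [curvatureField]
  abel

theorem curvature_swap (x : M) (u v w : TangentSpace 𝓘(ℝ, E) x) :
    curvature x u v w = -curvature x v u w := by
  simp only [curvature_eq_curvatureField]
  exact curvatureField_swap _ _ _ _

theorem curvature_self (x : M) (u w : TangentSpace 𝓘(ℝ, E) x) : curvature x u u w = 0 := by
  have h : (2 : ℝ) • curvature x u u w = 0 := by
    rw [two_smul]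
    nth_rw 1 [curvature_swap]
    exact neg_add_cancel _
  simpa using h

theorem curvature_bianchi (x : M) (u v w : TangentSpace 𝓘(ℝ, E) x) :
    curvature x u v w + curvature x v w u + curvature x w u v = 0 := by
  simp only [curvature_eq_curvatureField]
  exact curvatureField_bianchi (contMDiffAt_extend_vector u) (contMDiffAt_extend_vector v)
    (contMDiffAt_extend_vector w)

theorem inner_curvature_add (x : M) (u v w z : TangentSpace 𝓘(ℝ, E) x) :
    ⟪curvature x u v w, z⟫ + ⟪w, curvature x u v z⟫ = 0 := by
  have h := inner_curvatureField_add (contMDiffAt_extend_vector u) (contMDiffAt_extend_vector v)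
    (contMDiffAt_extend_vector w) (contMDiffAt_extend_vector z)
  simpa only [curvature_eq_curvatureField, FiberBundle.extend_apply_self] using h

/-- The curvature operator is pointwise in the differentiated field. -/
theorem curvatureField_extend {Z : Π x : M, TangentSpace 𝓘(ℝ, E) x} {x : M}
    (hZ : CMDiffAt ∞ (T% Z) x) (u v : TangentSpace 𝓘(ℝ, E) x) :
    curvatureField (FiberBundle.extend E u) (FiberBundle.extend E v) Z x =
      curvature x u v (Z x) := by
  refine eq_of_inner_eq fun w ↦ ?_
  -- Skew-symmetry moves the operator from `Z` onto the other argument, leaving only the value of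
  -- `Z` at `x`.
  have h1 := inner_curvatureField_add (contMDiffAt_extend_vector u) (contMDiffAt_extend_vector v)
    hZ (contMDiffAt_extend_vector w)
  have h2 := inner_curvature_add x u v (Z x) w
  rw [← curvature_eq_curvatureField, FiberBundle.extend_apply_self] at h1
  linarith

/-! ### Killing fields -/

theorem lieDerivMetric_eq {V Y Z : Π x : M, TangentSpace 𝓘(ℝ, E) x} {x : M}
    (hV : MDiffAt (T% V) x) (hY : MDiffAt (T% Y) x) (hZ : MDiffAt (T% Z) x) :
    lieDerivMetric V Y Z x =
      ⟪leviCivita V x (Y x), Z x⟫ + ⟪Y x, leviCivita V x (Z x)⟫ := by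
  rw [lieDerivMetric, leviCivita_metric_apply hY hZ, ← leviCivita_torsion_free hV hY,
    ← leviCivita_torsion_free hV hZ, inner_sub_left, inner_sub_right]
  ring

theorem IsKilling.inner_leviCivita_add {X : Π x : M, TangentSpace 𝓘(ℝ, E) x} (hX : IsKilling X)
    {x : M} (u v : TangentSpace 𝓘(ℝ, E) x) :
    ⟪leviCivita X x u, v⟫ + ⟪u, leviCivita X x v⟫ = 0 := by
  have hu := FiberBundle.mdifferentiableAt_extend 𝓘(ℝ, E) E u
  have hv := FiberBundle.mdifferentiableAt_extend 𝓘(ℝ, E) E v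
  have h := hX.2 x _ _ hu hv
  rwa [lieDerivMetric_eq (mdiffAt_of_contMDiffAt (hX.1 x)) hu hv, FiberBundle.extend_apply_self,
    FiberBundle.extend_apply_self] at h

/-- Kostant's formula: for a Killing field `X`, the derivative `(∇_u (∇ X)) w` is `R(u, X) w`. -/
theorem IsKilling.second_derivative {X : Π x : M, TangentSpace 𝓘(ℝ, E) x} (hX : IsKilling X)
    {x : M} (u w : TangentSpace 𝓘(ℝ, E) x) :
    leviCivita (fun y ↦ leviCivita X y (FiberBundle.extend E w y)) x u
      - leviCivita X x (leviCivita (FiberBundle.extend E w) x u) = curvature x u (X x) w := by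
  have hXx := hX.1 x
  -- `B` is the defect in the formula. It is symmetric in its two arguments by the Bianchi identity,
  -- while g(B(u, w), v) is skew in w and v by the Killing equation. Alternating the two symmetries
  -- gives B = -B.
  set B : TangentSpace 𝓘(ℝ, E) x → TangentSpace 𝓘(ℝ, E) x → TangentSpace 𝓘(ℝ, E) x :=
    fun u w ↦ leviCivita (fun y ↦ leviCivita X y (FiberBundle.extend E w y)) x u
      - leviCivita X x (leviCivita (FiberBundle.extend E w) x u) - curvature x u (X x) w with hB
  have symm : ∀ u w, B u w = B w u := by
    intro u w
    have h1 := curvatureField_extend hXx u w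
    have h2 := curvature_bianchi x u w (X x)
    have h3 := curvature_swap x (X x) u w
    have h4 := leviCivita_torsion_free
      (FiberBundle.mdifferentiableAt_extend 𝓘(ℝ, E) E u)
      (FiberBundle.mdifferentiableAt_extend 𝓘(ℝ, E) E w)
    simp only [curvatureField, FiberBundle.extend_apply_self, ← h4, map_sub] at h1
    rw [h3, ← h1] at h2
    rw [← sub_eq_zero, ← h2]
    simp only [hB]
    abel
  have skew : ∀ u w v, ⟪B u w, v⟫ = -⟪B u v, w⟫ := by
    intro u w v
    have hw := contMDiffAt_extend_vector w
    have hv := contMDiffAt_extend_vector v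
    have h1 := contMDiffAt_leviCivita hw hXx
    have h2 := contMDiffAt_leviCivita hv hXx
    -- The derivative of the Killing equation along `u`.
    have he : (fun y ↦ ⟪leviCivita X y (FiberBundle.extend E w y), FiberBundle.extend E v y⟫)
        + (fun y ↦ ⟪(FiberBundle.extend E w y : TangentSpace 𝓘(ℝ, E) y),
          leviCivita X y (FiberBundle.extend E v y)⟫) = fun _ ↦ 0 :=
      funext fun y ↦ hX.inner_leviCivita_add _ _
    have hd := mvfderiv_add (I := 𝓘(ℝ, E)) (x := x)
      ((contMDiffAt_inner h1 hv).mdifferentiableAt (by simp))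
      ((contMDiffAt_inner hw h2).mdifferentiableAt (by simp))
    rw [he, mvfderiv_const] at hd
    have hd' := congrArg (fun φ ↦ φ u) hd
    simp only [_root_.add_apply, _root_.zero_apply] at hd'
    rw [leviCivita_metric_apply (mdiffAt_of_contMDiffAt h1) (mdiffAt_of_contMDiffAt hv),
      leviCivita_metric_apply (mdiffAt_of_contMDiffAt hw) (mdiffAt_of_contMDiffAt h2)] at hd'
    simp only [FiberBundle.extend_apply_self] at hd'
    have k1 := hX.inner_leviCivita_add w (leviCivita (FiberBundle.extend E v) x u)
    have k2 := hX.inner_leviCivita_add (leviCivita (FiberBundle.extend E w) x u) v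
    have k3 := inner_curvature_add x u (X x) w v
    simp only [hB, inner_sub_left]
    rw [real_inner_comm w, real_inner_comm w, real_inner_comm w]
    linarith
  rw [← sub_eq_zero]
  refine eq_of_inner_eq fun v ↦ ?_
  change ⟪B u w, v⟫ = ⟪(0 : TangentSpace 𝓘(ℝ, E) x), v⟫
  have h1 := skew u w v
  have h2 := skew v u w
  have h3 := skew w v u
  rw [symm u v] at h1
  rw [symm v w] at h2
  rw [symm w u] at h3
  rw [inner_zero_left]
  linarith

/-! ### Gradient and Hessian -/

theorem inner_grad (τ : M → ℝ) (x : M) (w : TangentSpace 𝓘(ℝ, E) x) :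
    ⟪grad τ x, w⟫ = d% τ x w :=
  sharp_inner _ _

theorem contMDiffAt_grad {τ : M → ℝ} {x : M} (hτ : CMDiffAt ∞ τ x) :
    CMDiffAt ∞ (T% (grad τ : Π y : M, TangentSpace 𝓘(ℝ, E) y)) x := by
  refine contMDiffAt_of_inner_extend fun W hW ↦ ?_
  simp only [inner_grad]
  exact contMDiffAt_mvfderiv hτ hW

/-- The difference of the two sides is the commutator formula for `τ` with the bracket rewritten by
torsion-freeness. -/
theorem inner_leviCivita_grad_comm {τ : M → ℝ} {x : M} (hτ : CMDiffAt ∞ τ x)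
    (u w : TangentSpace 𝓘(ℝ, E) x) :
    ⟪leviCivita (grad τ) x u, w⟫ = ⟪u, leviCivita (grad τ) x w⟫ := by
  have hu := contMDiffAt_extend_vector u
  have hw := contMDiffAt_extend_vector w
  have hg := mdiffAt_of_contMDiffAt (contMDiffAt_grad hτ)
  have h := mvfderiv_mvfderiv_sub hτ hu hw
  simp only [← inner_grad] at h
  rw [inner_grad (fun y ↦ ⟪grad τ y, FiberBundle.extend E w y⟫),
    inner_grad (fun y ↦ ⟪grad τ y, FiberBundle.extend E u y⟫), ← leviCivita_torsion_free (mdiffAt_of_contMDiffAt hu)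
    (mdiffAt_of_contMDiffAt hw),
    leviCivita_metric_apply hg (mdiffAt_of_contMDiffAt hw),
    leviCivita_metric_apply hg (mdiffAt_of_contMDiffAt hu)] at h
  simp only [FiberBundle.extend_apply_self, inner_sub_right] at h
  rw [real_inner_comm _ u]
  linarith

section Kahler

variable {J : Π x : M, TangentSpace 𝓘(ℝ, E) x →L[ℝ] TangentSpace 𝓘(ℝ, E) x} {τ : M → ℝ}

theorem IsKahler.contMDiffAt_apply (hJ : IsKahler J) {Y : Π x : M, TangentSpace 𝓘(ℝ, E) x}
    {x : M} (hY : CMDiffAt ∞ (T% Y) x) : CMDiffAt ∞ (T% (fun y ↦ J y (Y y))) x :=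
  ContMDiffAt.clm_bundle_apply (b := fun x ↦ x) (hJ.smooth x) hY

theorem IsKahler.mdiffAt_apply (hJ : IsKahler J) {Y : Π x : M, TangentSpace 𝓘(ℝ, E) x}
    {x : M} (hY : MDiffAt (T% Y) x) : MDiffAt (T% (fun y ↦ J y (Y y))) x :=
  MDifferentiableAt.clm_bundle_apply (b := fun x ↦ x)
    ((hJ.smooth x).mdifferentiableAt (by simp)) hY

theorem IsKahler.inner_apply_left (hJ : IsKahler J) {x : M} (u v : TangentSpace 𝓘(ℝ, E) x) :
    ⟪J x u, v⟫ = -⟪u, J x v⟫ := by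
  rw [← hJ.inner_map_map x u (J x v), hJ.sq_eq_neg, inner_neg_right, neg_neg]

theorem IsKahler.inner_apply_self (hJ : IsKahler J) {x : M} (u : TangentSpace 𝓘(ℝ, E) x) :
    ⟪J x u, u⟫ = 0 := by
  have h := hJ.inner_apply_left u u
  rw [real_inner_comm (J x u) u] at h
  linarith

theorem leviCivita_apply_grad (hJ : IsKahler J) (hτ : IsSpecialKahlerPotential J τ) (x : M)
    (u : TangentSpace 𝓘(ℝ, E) x) :
    leviCivita (fun y ↦ J y (grad τ y)) x u = J x (leviCivita (grad τ) x u) :=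
  hJ.parallel x _ (mdiffAt_of_contMDiffAt (contMDiffAt_grad (hτ.smooth x))) u

/-- The Killing equation says that JS is skew. As S is symmetric and J is skew, S and J commute. -/
theorem leviCivita_grad_apply (hJ : IsKahler J) (hτ : IsSpecialKahlerPotential J τ) (x : M)
    (u : TangentSpace 𝓘(ℝ, E) x) :
    leviCivita (grad τ) x (J x u) = J x (leviCivita (grad τ) x u) := by
  refine eq_of_inner_eq fun v ↦ ?_
  have h := hτ.killing.inner_leviCivita_add u v
  rw [leviCivita_apply_grad hJ hτ, leviCivita_apply_grad hJ hτ] at h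
  have h1 := hJ.inner_apply_left u (leviCivita (grad τ) x v)
  rw [inner_leviCivita_grad_comm (hτ.smooth x)]
  linarith

end Kahler

/-! ### The eigenvalues of the Hessian and their smoothness -/

section Potential

variable {J : Π x : M, TangentSpace 𝓘(ℝ, E) x →L[ℝ] TangentSpace 𝓘(ℝ, E) x} {τ : M → ℝ}

theorem grad_ne_zero_iff {x : M} : grad (E := E) τ x ≠ 0 ↔ d% τ x ≠ 0 := by
  rw [not_iff_not]
  constructor
  · intro h
    ext w
    rw [← inner_grad, h, inner_zero_left, _root_.zero_apply]
  · intro h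
    refine eq_of_inner_eq fun w ↦ ?_
    rw [inner_grad, h, inner_zero_left, _root_.zero_apply]

theorem inner_grad_self_ne_zero {x : M} (hx : d% τ x ≠ 0) : ⟪grad (E := E) τ x, grad (E := E) τ x⟫ ≠ 0 := by
  rw [inner_self_ne_zero]
  exact grad_ne_zero_iff.2 hx

theorem mem_orthogonal_potentialDistribution {x : M} {w : TangentSpace 𝓘(ℝ, E) x} :
    w ∈ (potentialDistribution J τ x)ᗮ ↔
      ⟪grad (E := E) τ x, w⟫ = 0 ∧ ⟪J x (grad (E := E) τ x), w⟫ = 0 := by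
  rw [potentialDistribution, Submodule.span_insert, ← Submodule.inf_orthogonal,
    Submodule.mem_inf, Submodule.mem_orthogonal_singleton_iff_inner_right,
    Submodule.mem_orthogonal_singleton_iff_inner_right]

theorem linearIndependent_grad (hJ : IsKahler J) {x : M} (hx : d% τ x ≠ 0) :
    LinearIndependent ℝ ![grad τ x, J x (grad (E := E) τ x)] := by
  rw [LinearIndependent.pair_iff]
  intro a b h
  have hQ := inner_grad_self_ne_zero hx
  have h0 := hJ.inner_apply_self (grad (E := E) τ x)
  have h1 := congrArg (fun v ↦ ⟪v, grad (E := E) τ x⟫) h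
  have h2 := congrArg (fun v ↦ ⟪v, J x (grad (E := E) τ x)⟫) h
  simp only [inner_add_left, inner_smul_left, inner_zero_left, hJ.inner_map_map, h0,
    real_inner_comm (J x (grad (E := E) τ x)) (grad (E := E) τ x)] at h1 h2
  simpa [grad_ne_zero_iff.2 hx] using And.intro h1 h2

theorem finrank_potentialDistribution (hJ : IsKahler J) {x : M} (hx : d% τ x ≠ 0) :
    Module.finrank ℝ (potentialDistribution J τ x) = 2 := by
  have h := finrank_span_eq_card (linearIndependent_grad hJ hx)
  rw [Matrix.range_cons, Matrix.range_cons, Matrix.range_empty, Set.union_empty,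
    Set.singleton_union] at h
  exact h

theorem orthogonal_potentialDistribution_eq_bot_iff (hJ : IsKahler J) {x : M}
    (hx : d% τ x ≠ 0) : (potentialDistribution J τ x)ᗮ = ⊥ ↔ Module.finrank ℝ E = 2 := by
  have h := Submodule.finrank_add_finrank_orthogonal (potentialDistribution J τ x)
  rw [finrank_potentialDistribution hJ hx] at h
  rw [← Submodule.finrank_eq_zero (R := ℝ)]
  change _ = Module.finrank ℝ E at h
  omega

/-- The transverse part of a vector. -/
theorem sub_mem_orthogonal (hJ : IsKahler J) {x : M} (hx : d% τ x ≠ 0)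
    (w : TangentSpace 𝓘(ℝ, E) x) :
    w - (⟪grad (E := E) τ x, w⟫ / ⟪grad (E := E) τ x, grad (E := E) τ x⟫) • grad (E := E) τ x
      - (⟪J x (grad (E := E) τ x), w⟫ / ⟪grad (E := E) τ x, grad (E := E) τ x⟫) • J x (grad (E := E) τ x) ∈
        (potentialDistribution J τ x)ᗮ := by
  have hQ := inner_grad_self_ne_zero hx
  have h0 := hJ.inner_apply_self (grad (E := E) τ x)
  have h0' := h0
  rw [real_inner_comm] at h0'
  rw [mem_orthogonal_potentialDistribution]
  simp only [inner_sub_right, inner_smul_right, hJ.inner_map_map, h0, h0']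
  constructor <;> field_simp <;> ring

/-- If every nonzero vector of a subspace is an eigenvector, there is only one eigenvalue. For
vectors that are not orthogonal, symmetry of the Hessian equates their eigenvalues. For orthogonal
ones, comparing components in the eigenvector equation of their sum does. -/
theorem exists_transverse_eigenvalue (hJ : IsKahler J) (hτ : IsSpecialKahlerPotential J τ) {x : M}
    (hx : d% τ x ≠ 0) :
    ∃ c : ℝ, ∀ w ∈ (potentialDistribution J τ x)ᗮ, leviCivita (grad (E := E) τ) x w = c • w := by
  have eig : ∀ w ∈ (potentialDistribution J τ x)ᗮ, w ≠ 0 →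
      ∃ μ : ℝ, leviCivita (grad (E := E) τ) x w = μ • w := by
    intro w hw hw0
    rw [mem_orthogonal_potentialDistribution] at hw
    obtain ⟨μ, hμ⟩ := hτ.eigenvector x hx w hw0 hw.2
      (by rw [hJ.sq_eq_neg, inner_neg_left, hw.1, neg_zero])
    refine ⟨μ, eq_of_inner_eq fun u ↦ ?_⟩
    rw [inner_smul_left]
    exact hμ u
  by_cases h : ∃ w ∈ (potentialDistribution J τ x)ᗮ, w ≠ 0
  · obtain ⟨w₀, hw₀, h0⟩ := h
    obtain ⟨c, hc⟩ := eig w₀ hw₀ h0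
    refine ⟨c, fun w hw ↦ ?_⟩
    by_cases hw0 : w = 0
    · simp [hw0]
    obtain ⟨μ, hμ⟩ := eig w hw hw0
    have hs := inner_leviCivita_grad_comm (hτ.smooth x) w w₀
    rw [hc, hμ, inner_smul_left, inner_smul_right] at hs
    have hs' : (μ - c) * ⟪w, w₀⟫ = 0 := by
      simp only [conj_trivial] at hs
      linarith
    rcases mul_eq_zero.1 hs' with hmu | hin
    · rw [hμ, sub_eq_zero.1 hmu]
    have hin' : ⟪w₀, w⟫ = 0 := by rw [real_inner_comm, hin]
    have hww : ⟪w, w⟫ ≠ 0 := inner_self_ne_zero.2 hw0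
    have hww' : ⟪w₀, w₀⟫ ≠ 0 := inner_self_ne_zero.2 h0
    have hne : w + w₀ ≠ 0 := by
      intro h'
      have := congrArg (fun v ↦ ⟪v, w⟫) h'
      simp only [inner_add_left, hin', add_zero, inner_zero_left] at this
      exact hww this
    obtain ⟨ν, hν⟩ := eig (w + w₀) (Submodule.add_mem _ hw hw₀) hne
    rw [map_add, hμ, hc] at hν
    have h1 := congrArg (fun v ↦ ⟪v, w⟫) hν
    have h2 := congrArg (fun v ↦ ⟪v, w₀⟫) hν
    simp only [inner_add_left, inner_smul_left, hin, hin', add_zero, zero_add, mul_zero,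
      conj_trivial] at h1 h2
    rw [hμ, mul_right_cancel₀ hww h1, mul_right_cancel₀ hww' h2]
  · push Not at h
    exact ⟨0, fun w hw ↦ by simp [h w hw]⟩

/-- The eigenvalue of the Hessian of `τ` on the gradient. -/
def gradEigenvalue (τ : M → ℝ) (x : M) : ℝ :=
  ⟪leviCivita (grad (E := E) τ) x (grad (E := E) τ x), grad (E := E) τ x⟫ / ⟪grad (E := E) τ x, grad (E := E) τ x⟫

theorem leviCivita_grad_grad (hJ : IsKahler J) (hτ : IsSpecialKahlerPotential J τ) {x : M}
    (hx : d% τ x ≠ 0) : leviCivita (grad (E := E) τ) x (grad (E := E) τ x) = gradEigenvalue (E := E) τ x • grad (E := E) τ x := by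
  obtain ⟨c, hc⟩ := exists_transverse_eigenvalue hJ hτ hx
  have hQ := inner_grad_self_ne_zero hx
  have hr := sub_mem_orthogonal hJ hx (leviCivita (grad (E := E) τ) x (grad (E := E) τ x))
  have h0 : ⟪J x (grad (E := E) τ x), leviCivita (grad (E := E) τ) x (grad (E := E) τ x)⟫ = 0 := by
    have h1 := inner_leviCivita_grad_comm (hτ.smooth x) (J x (grad (E := E) τ x)) (grad (E := E) τ x)
    rw [leviCivita_grad_apply hJ hτ, hJ.inner_apply_left, real_inner_comm] at h1
    linarith
  rw [h0, zero_div, zero_smul, sub_zero, real_inner_comm (leviCivita (grad (E := E) τ) x (grad (E := E) τ x))] at hr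
  change _ - gradEigenvalue (E := E) τ x • grad (E := E) τ x ∈ _ at hr
  have hr' := hr
  rw [mem_orthogonal_potentialDistribution] at hr'
  set r := leviCivita (grad (E := E) τ) x (grad (E := E) τ x) - gradEigenvalue (E := E) τ x • grad (E := E) τ x with hrdef
  -- The remainder r = ST - ψT lies in 𝒱^⊥, so g(r, r) = g(ST, r) = g(T, Sr) = c g(T, r) = 0.
  rw [← sub_eq_zero, ← hrdef, ← inner_self_eq_zero (𝕜 := ℝ)]
  nth_rw 1 [hrdef]
  rw [inner_sub_left, inner_smul_left, hr'.1, inner_leviCivita_grad_comm (hτ.smooth x), hc r hr,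
    inner_smul_right, hr'.1]
  simp

/-- `c` is the eigenvalue of the Hessian of `τ` on the orthogonal complement of the distribution
`span{∇τ, J∇τ}`; if that complement vanishes, the eigenvalue on the gradient is taken instead. -/
def IsTransverseEigenvalue (J : Π x : M, TangentSpace 𝓘(ℝ, E) x →L[ℝ] TangentSpace 𝓘(ℝ, E) x)
    (τ : M → ℝ) (x : M) (c : ℝ) : Prop :=
  (∀ w ∈ (potentialDistribution J τ x)ᗮ, leviCivita (grad (E := E) τ) x w = c • w) ∧
    ((potentialDistribution J τ x)ᗮ = ⊥ → c = gradEigenvalue (E := E) τ x)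

open Classical in
/-- The eigenvalue of the Hessian transverse to `span{∇τ, J∇τ}`. -/
def transverseEigenvalue (J : Π x : M, TangentSpace 𝓘(ℝ, E) x →L[ℝ] TangentSpace 𝓘(ℝ, E) x)
    (τ : M → ℝ) (x : M) : ℝ :=
  if h : ∃ c, IsTransverseEigenvalue J τ x c then h.choose else 0

theorem isTransverseEigenvalue_transverseEigenvalue (hJ : IsKahler J)
    (hτ : IsSpecialKahlerPotential J τ) {x : M} (hx : d% τ x ≠ 0) :
    IsTransverseEigenvalue J τ x (transverseEigenvalue J τ x) := by
  have h : ∃ c, IsTransverseEigenvalue J τ x c := by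
    by_cases h : (potentialDistribution J τ x)ᗮ = ⊥
    · refine ⟨gradEigenvalue (E := E) τ x, fun w hw ↦ ?_, fun _ ↦ rfl⟩
      rw [h, Submodule.mem_bot] at hw
      simp [hw]
    · obtain ⟨c, hc⟩ := exists_transverse_eigenvalue hJ hτ hx
      exact ⟨c, hc, fun h' ↦ (h h').elim⟩
  rw [transverseEigenvalue, dif_pos h]
  exact h.choose_spec

/-- The coefficient of the rank two part of the Hessian. -/
def hessianCoeff (J : Π x : M, TangentSpace 𝓘(ℝ, E) x →L[ℝ] TangentSpace 𝓘(ℝ, E) x)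
    (τ : M → ℝ) (x : M) : ℝ :=
  (gradEigenvalue (E := E) τ x - transverseEigenvalue J τ x) / ⟪grad (E := E) τ x, grad (E := E) τ x⟫

/-- The Hessian of a special Kähler potential has at most two eigenvalues. -/
theorem leviCivita_grad_eq (hJ : IsKahler J) (hτ : IsSpecialKahlerPotential J τ) {x : M}
    (hx : d% τ x ≠ 0) (w : TangentSpace 𝓘(ℝ, E) x) :
    leviCivita (grad (E := E) τ) x w = transverseEigenvalue J τ x • w + hessianCoeff J τ x •
      (⟪grad (E := E) τ x, w⟫ • grad (E := E) τ x + ⟪J x (grad (E := E) τ x), w⟫ • J x (grad (E := E) τ x)) := by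
  have hQ := inner_grad_self_ne_zero hx
  -- S is the scalar φ on the transverse part of `w`, and its values on T and X = JT are known.
  have h := (isTransverseEigenvalue_transverseEigenvalue hJ hτ hx).1 _ (sub_mem_orthogonal hJ hx w)
  simp only [map_sub, map_smul, leviCivita_grad_apply hJ hτ, leviCivita_grad_grad hJ hτ hx] at h
  rw [sub_sub, sub_eq_iff_eq_add] at h
  rw [h, hessianCoeff]
  match_scalars <;> field_simp <;> ring

theorem contMDiffAt_gradEigenvalue (hτ : CMDiff ∞ τ) {x : M} (hx : d% τ x ≠ 0) :
    CMDiffAt ∞ (gradEigenvalue (E := E) τ) x := by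
  have hT := contMDiffAt_grad (E := E) (hτ x)
  exact (contMDiffAt_inner (contMDiffAt_leviCivita hT hT) hT).div₀ (contMDiffAt_inner hT hT)
    (inner_grad_self_ne_zero hx)

theorem isOpen_setOf_mvfderiv_ne_zero (hτ : CMDiff ∞ τ) : IsOpen {x : M | d% τ x ≠ 0} := by
  have h : {x : M | d% τ x ≠ 0} = {x : M | ⟪grad (E := E) τ x, grad (E := E) τ x⟫ ≠ 0} := by
    ext x
    simp only [Set.mem_ofPred_eq, ← grad_ne_zero_iff, ne_eq, inner_self_eq_zero]
  rw [h]
  refine isOpen_ne_fun (continuous_iff_continuousAt.2 fun x ↦ ?_) continuous_const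
  have hT := contMDiffAt_grad (E := E) (hτ x)
  exact (contMDiffAt_inner hT hT).continuousAt

/-- Near a point where 𝒱^⊥ ≠ 0, the eigenvalue is the Rayleigh quotient of a smooth nonvanishing
field in 𝒱^⊥. Otherwise the real dimension is two and it equals `gradEigenvalue` nearby. -/
theorem contMDiffAt_transverseEigenvalue (hJ : IsKahler J) (hτ : IsSpecialKahlerPotential J τ)
    {x : M} (hx : d% τ x ≠ 0) : CMDiffAt ∞ (transverseEigenvalue J τ) x := by
  have hU : ∀ᶠ y in 𝓝 x, d% τ y ≠ 0 := (isOpen_setOf_mvfderiv_ne_zero hτ.smooth).mem_nhds hx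
  by_cases h : (potentialDistribution J τ x)ᗮ = ⊥
  · rw [orthogonal_potentialDistribution_eq_bot_iff hJ hx] at h
    refine (contMDiffAt_gradEigenvalue hτ.smooth hx).congr_of_eventuallyEq ?_
    filter_upwards [hU] with y hy
    exact (isTransverseEigenvalue_transverseEigenvalue hJ hτ hy).2
      ((orthogonal_potentialDistribution_eq_bot_iff hJ hy).2 h)
  obtain ⟨w, hw, hw0⟩ := Submodule.exists_mem_ne_zero_of_ne_bot h
  have hW := contMDiffAt_extend_vector w
  have hT := contMDiffAt_grad (E := E) (hτ.smooth x)
  have hX := hJ.contMDiffAt_apply hT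
  have hQ := contMDiffAt_inner hT hT
  have hQ0 := inner_grad_self_ne_zero hx
  -- The extension of `w` projected pointwise onto 𝒱^⊥.
  let Z : Π y : M, TangentSpace 𝓘(ℝ, E) y := FiberBundle.extend E w
    - (fun y ↦ ⟪grad (E := E) τ y, FiberBundle.extend E w y⟫ / ⟪grad (E := E) τ y, grad (E := E) τ y⟫) • grad (E := E) τ
    - (fun y ↦ ⟪J y (grad (E := E) τ y), FiberBundle.extend E w y⟫ / ⟪grad (E := E) τ y, grad (E := E) τ y⟫) •
      (fun y ↦ J y (grad (E := E) τ y))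
  have hZ : CMDiffAt ∞ (T% Z) x :=
    (hW.sub_section (((contMDiffAt_inner hT hW).div₀ hQ hQ0).smul_section hT)).sub_section
      (((contMDiffAt_inner hX hW).div₀ hQ hQ0).smul_section hX)
  have hZx : Z x = w := by
    rw [mem_orthogonal_potentialDistribution] at hw
    simp [Z, hw.1, hw.2]
  have hZ0 : ⟪Z x, Z x⟫ ≠ 0 := by rwa [hZx, inner_self_ne_zero]
  have hφ := (contMDiffAt_inner (contMDiffAt_leviCivita hZ hT) hZ).div₀
    (contMDiffAt_inner hZ hZ) hZ0
  refine hφ.congr_of_eventuallyEq ?_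
  filter_upwards [hU, (contMDiffAt_inner hZ hZ).continuousAt.eventually_ne hZ0] with y hy hy0
  rw [Pi.div_apply, eq_div_iff hy0, (isTransverseEigenvalue_transverseEigenvalue hJ hτ hy).1 (Z y)
    (sub_mem_orthogonal hJ hy _), inner_smul_left]
  rfl

theorem contMDiffAt_hessianCoeff (hJ : IsKahler J) (hτ : IsSpecialKahlerPotential J τ)
    {x : M} (hx : d% τ x ≠ 0) : CMDiffAt ∞ (hessianCoeff J τ) x := by
  have hT := contMDiffAt_grad (E := E) (hτ.smooth x)
  exact ((contMDiffAt_gradEigenvalue hτ.smooth hx).sub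
    (contMDiffAt_transverseEigenvalue hJ hτ hx)).div₀ (contMDiffAt_inner hT hT)
      (inner_grad_self_ne_zero hx)

end Potential

/-! ### Curvature and Ricci tensor in the direction J∇τ -/

section Ricci

variable {J : Π x : M, TangentSpace 𝓘(ℝ, E) x →L[ℝ] TangentSpace 𝓘(ℝ, E) x} {τ : M → ℝ}

theorem eventually_mvfderiv_ne_zero (hτ : CMDiff ∞ τ) {x : M} (hx : d% τ x ≠ 0) :
    ∀ᶠ y in 𝓝 x, d% τ y ≠ 0 :=
  (isOpen_setOf_mvfderiv_ne_zero hτ).mem_nhds hx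

/-- The operators `R(u, J∇τ)` in terms of the eigenvalues of the Hessian of `τ`. -/
theorem curvature_apply_grad (hJ : IsKahler J) (hτ : IsSpecialKahlerPotential J τ) {x : M}
    (hx : d% τ x ≠ 0) (u w : TangentSpace 𝓘(ℝ, E) x) :
    curvature x u (J x (grad (E := E) τ x)) w =
      d% (transverseEigenvalue J τ) x u • J x w
      + d% (hessianCoeff J τ) x u •
        (⟪grad (E := E) τ x, w⟫ • J x (grad τ x) - ⟪J x (grad (E := E) τ x), w⟫ • grad τ x)
      + hessianCoeff J τ x •
        (⟪leviCivita (grad (E := E) τ) x u, w⟫ • J x (grad τ x)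
          + ⟪grad (E := E) τ x, w⟫ • J x (leviCivita (grad τ) x u)
          - ⟪J x (leviCivita (grad (E := E) τ) x u), w⟫ • grad τ x
          - ⟪J x (grad (E := E) τ x), w⟫ • leviCivita (grad τ) x u) := by
  rw [← hτ.killing.second_derivative u w]
  set W : Π y : M, TangentSpace 𝓘(ℝ, E) y := FiberBundle.extend E w with hWdef
  set X : Π y : M, TangentSpace 𝓘(ℝ, E) y := fun y ↦ J y (grad τ y) with hXdef
  have hW := contMDiffAt_extend_vector w
  have hT := contMDiffAt_grad (E := E) (hτ.smooth x)
  have hX := hJ.contMDiffAt_apply hT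
  have hJW := hJ.contMDiffAt_apply hW
  have hφ := contMDiffAt_transverseEigenvalue hJ hτ hx
  have hσ := contMDiffAt_hessianCoeff hJ hτ hx
  have ha := contMDiffAt_inner hT hW
  have hb := contMDiffAt_inner hX hW
  -- This is ∇X = JS = φJ + σ(T♭⊗X - X♭⊗T). By Kostant's formula, its covariant derivative is R(u,
  -- X).
  have apply_eq : ∀ y, d% τ y ≠ 0 → ∀ v : TangentSpace 𝓘(ℝ, E) y, leviCivita X y v =
      transverseEigenvalue J τ y • J y v + hessianCoeff J τ y •
        (⟪grad τ y, v⟫ • X y + (-⟪X y, v⟫) • grad τ y) := by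
    intro y hy v
    rw [leviCivita_apply_grad hJ hτ, leviCivita_grad_eq hJ hτ hy]
    simp only [map_add, map_smul, hJ.sq_eq_neg, hXdef]
    module
  have he : (fun y ↦ leviCivita X y (W y)) =ᶠ[𝓝 x]
      transverseEigenvalue J τ • (fun y ↦ J y (W y)) + hessianCoeff J τ •
        ((fun y ↦ ⟪grad τ y, W y⟫) • X + (fun y ↦ -⟪X y, W y⟫) • grad τ) := by
    filter_upwards [eventually_mvfderiv_ne_zero hτ.smooth hx] with y hy
    exact apply_eq y hy (W y)
  have s1 := ha.smul_section hX
  have s2 := hb.neg.smul_section hT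
  have s3 := s1.add_section s2
  have s4 := hσ.smul_section s3
  have s5 := hφ.smul_section hJW
  have m : ∀ {Y : Π x : M, TangentSpace 𝓘(ℝ, E) x}, CMDiffAt ∞ (T% Y) x → MDiffAt (T% Y) x :=
    mdiffAt_of_contMDiffAt
  have mf : ∀ {f : M → ℝ}, CMDiffAt ∞ f x → MDiffAt f x :=
    fun h ↦ h.mdifferentiableAt (by simp)
  rw [← leviCivita_congr (m (s5.add_section s4)) he.symm, leviCivita_add (m s5) (m s4),
    _root_.add_apply, leviCivita_smul (mf hφ) (m hJW), leviCivita_smul (mf hσ) (m s3),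
    leviCivita_add (m s1) (m s2), _root_.add_apply, leviCivita_smul (mf ha) (m hX),
    leviCivita_smul (mf hb.neg) (m hT), hJ.parallel x W (m hW), mvfderiv_fun_neg,
    _root_.neg_apply, leviCivita_metric_apply (m hT) (m hW), leviCivita_metric_apply (m hX) (m hW),
    apply_eq x hx (leviCivita W x u), hXdef, leviCivita_apply_grad hJ hτ]
  simp only [Pi.add_apply, Pi.smul_apply', hWdef, FiberBundle.extend_apply_self]
  module

theorem hessianCoeff_eq_zero (hJ : IsKahler J) (hτ : IsSpecialKahlerPotential J τ) {x : M}
    (hx : d% τ x ≠ 0) (hE : Module.finrank ℝ E = 2) : hessianCoeff J τ x = 0 := by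
  rw [hessianCoeff, (isTransverseEigenvalue_transverseEigenvalue hJ hτ hx).2
    ((orthogonal_potentialDistribution_eq_bot_iff hJ hx).2 hE), sub_self, zero_div]

theorem leviCivita_grad_apply_grad (hJ : IsKahler J) (hτ : IsSpecialKahlerPotential J τ) {x : M}
    (hx : d% τ x ≠ 0) : leviCivita (grad (E := E) τ) x (J x (grad τ x)) =
      gradEigenvalue (E := E) τ x • J x (grad τ x) := by
  rw [leviCivita_grad_apply hJ hτ, leviCivita_grad_grad hJ hτ hx, map_smul]

/-- R(X, X) = 0, and because SX = ψX the undifferentiated σ terms cancel. This leaves a linear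
relation between Xφ and Xσ, which is tested on T and on a transverse vector. -/
theorem mvfderiv_eigenvalues_apply_grad (hJ : IsKahler J) (hτ : IsSpecialKahlerPotential J τ)
    {x : M} (hx : d% τ x ≠ 0) :
    d% (transverseEigenvalue J τ) x (J x (grad (E := E) τ x)) = 0 ∧
      d% (hessianCoeff J τ) x (J x (grad (E := E) τ x)) = 0 := by
  set p := d% (transverseEigenvalue J τ) x (J x (grad (E := E) τ x)) with hp
  set q := d% (hessianCoeff J τ) x (J x (grad (E := E) τ x)) with hq
  have key : ∀ w : TangentSpace 𝓘(ℝ, E) x, p • J x w + q •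
      (⟪grad τ x, w⟫ • J x (grad τ x) - ⟪J x (grad τ x), w⟫ • grad τ x) = 0 := by
    intro w
    have h := curvature_apply_grad hJ hτ hx (J x (grad (E := E) τ x)) w
    rw [curvature_self, leviCivita_grad_apply_grad hJ hτ hx, ← hp, ← hq] at h
    simp only [map_smul, hJ.sq_eq_neg, inner_smul_left, inner_neg_left, conj_trivial] at h
    rw [h]
    module
  have hQ := inner_grad_self_ne_zero (E := E) hx
  have h0 := hJ.inner_apply_self (grad (E := E) τ x)
  have h1 := congrArg (fun v ↦ ⟪v, J x (grad τ x)⟫) (key (grad τ x))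
  simp only [h0, inner_add_left, inner_sub_left, inner_smul_left, conj_trivial, hJ.inner_map_map,
    inner_zero_left, zero_mul, sub_zero] at h1
  have h2 : p + q * ⟪grad τ x, grad τ x⟫ = 0 :=
    mul_right_cancel₀ hQ (by rw [zero_mul]; linarith)
  -- In real dimension two there is no transverse vector to test on, but there σ vanishes
  -- identically near `x`.
  by_cases hE : Module.finrank ℝ E = 2
  · have hq0 : q = 0 := by
      have he : hessianCoeff J τ =ᶠ[𝓝 x] fun _ ↦ 0 := by
        filter_upwards [eventually_mvfderiv_ne_zero hτ.smooth hx] with y hy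
        exact hessianCoeff_eq_zero hJ hτ hy hE
      rw [hq, mvfderiv_congr he, mvfderiv_const, _root_.zero_apply]
    rw [hq0, zero_mul, add_zero] at h2
    exact ⟨h2, hq0⟩
  · rw [← orthogonal_potentialDistribution_eq_bot_iff hJ hx] at hE
    obtain ⟨w, hw, hw0⟩ := Submodule.exists_mem_ne_zero_of_ne_bot hE
    rw [mem_orthogonal_potentialDistribution] at hw
    have hp0 : p = 0 := by
      have h3 := congrArg (fun v ↦ ⟪v, J x w⟫) (key w)
      simp only [hw.1, hw.2, zero_smul, sub_zero, smul_zero, add_zero, inner_smul_left,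
        hJ.inner_map_map, inner_zero_left, conj_trivial] at h3
      exact (mul_eq_zero.1 h3).resolve_right (inner_self_ne_zero.2 hw0)
    rw [hp0, zero_add] at h2
    exact ⟨hp0, (mul_eq_zero.1 h2).resolve_right hQ⟩

theorem sum_mul_inner_orthonormalBasis {x : M} {ι : Type*} [Fintype ι]
    (b : OrthonormalBasis ι ℝ (TangentSpace 𝓘(ℝ, E) x)) (L : TangentSpace 𝓘(ℝ, E) x →L[ℝ] ℝ)
    (v : TangentSpace 𝓘(ℝ, E) x) : ∑ i, L (b i) * ⟪v, b i⟫ = L v := by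
  conv_rhs => rw [← b.sum_repr' v]
  rw [map_sum]
  refine Finset.sum_congr rfl fun i _ ↦ ?_
  rw [map_smul, smul_eq_mul, mul_comm, real_inner_comm]

/-- The Ricci curvature in the direction `J∇τ`. -/
theorem exists_ricci_apply_grad (hJ : IsKahler J) (hτ : IsSpecialKahlerPotential J τ) {x : M}
    (hx : d% τ x ≠ 0) : ∃ κ : ℝ, ∀ w : TangentSpace 𝓘(ℝ, E) x,
      ricci x (J x (grad τ x)) w =
        d% (transverseEigenvalue J τ) x (J x w) + κ * ⟪J x (grad τ x), w⟫ := by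
  let b := stdOrthonormalBasis ℝ (TangentSpace 𝓘(ℝ, E) x)
  -- κ = -(Tσ + σ tr S) collects the terms that are multiples of g(X, w).
  refine ⟨-(d% (hessianCoeff J τ) x (grad (E := E) τ x) + hessianCoeff J τ x *
    ∑ i, ⟪leviCivita (grad τ) x (b i), b i⟫), fun w ↦ ?_⟩
  have hterm : ∀ i, ⟪curvature x (b i) (J x (grad τ x)) w, b i⟫ =
      d% (transverseEigenvalue J τ) x (b i) * ⟪J x w, b i⟫
      + ⟪grad τ x, w⟫ * (d% (hessianCoeff J τ) x (b i) * ⟪J x (grad τ x), b i⟫)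
      - ⟪J x (grad τ x), w⟫ * (d% (hessianCoeff J τ) x (b i) * ⟪grad τ x, b i⟫)
      + hessianCoeff J τ x * (innerSL ℝ (leviCivita (grad τ) x w) (b i) * ⟪J x (grad τ x), b i⟫)
      + hessianCoeff J τ x * (innerSL ℝ (leviCivita (grad τ) x (J x w)) (b i) * ⟪grad τ x, b i⟫)
      - hessianCoeff J τ x * ⟪J x (grad τ x), w⟫ * ⟪leviCivita (grad τ) x (b i), b i⟫ := by
    intro i
    -- JS is skew, so its diagonal entries vanish.
    have hs := hτ.killing.inner_leviCivita_add (b i) (b i)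
    rw [leviCivita_apply_grad hJ hτ, real_inner_comm (J x (leviCivita (grad τ) x (b i)))] at hs
    have hs' : ⟪J x (leviCivita (grad τ) x (b i)), b i⟫ = 0 := by linarith
    have h1 : innerSL ℝ (leviCivita (grad τ) x w) (b i) = ⟪leviCivita (grad τ) x (b i), w⟫ := by
      rw [innerSL_apply_apply, inner_leviCivita_grad_comm (hτ.smooth x) (b i) w, real_inner_comm]
    have h2 : innerSL ℝ (leviCivita (grad τ) x (J x w)) (b i) =
        -⟪J x (leviCivita (grad τ) x (b i)), w⟫ := by
      rw [innerSL_apply_apply, inner_leviCivita_grad_comm (hτ.smooth x), hJ.inner_apply_left,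
        neg_inj, real_inner_comm]
    rw [curvature_apply_grad hJ hτ hx, h1, h2]
    simp only [inner_add_left, inner_sub_left, inner_smul_left, conj_trivial, hs']
    ring
  have hsum : ricci x (J x (grad τ x)) w = ∑ i, ⟪curvature x (b i) (J x (grad τ x)) w, b i⟫ := rfl
  rw [hsum, Finset.sum_congr rfl fun i _ ↦ hterm i]
  simp only [Finset.sum_add_distrib, Finset.sum_sub_distrib, ← Finset.mul_sum,
    sum_mul_inner_orthonormalBasis]
  -- After contraction Xσ = 0, and g(Sw, X) + g(SJw, T) = ψ(g(w, X) + g(Jw, T)) = 0.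
  rw [(mvfderiv_eigenvalues_apply_grad hJ hτ hx).2, innerSL_apply_apply, innerSL_apply_apply,
    inner_leviCivita_grad_comm (hτ.smooth x), inner_leviCivita_grad_comm (hτ.smooth x),
    leviCivita_grad_apply_grad hJ hτ hx, leviCivita_grad_grad hJ hτ hx, inner_smul_right,
    inner_smul_right, hJ.inner_apply_left w, real_inner_comm _ w]
  ring

/-- `J∇τ` is an eigenvector of the Ricci tensor if and only if the differential of the transverse
eigenvalue is a multiple of `dτ`. -/
theorem ricci_eigenvector_iff (hJ : IsKahler J) (hτ : IsSpecialKahlerPotential J τ) {x : M}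
    (hx : d% τ x ≠ 0) :
    (∃ c : ℝ, ∀ w : TangentSpace 𝓘(ℝ, E) x,
      ricci x (J x (grad τ x)) w = c * ⟪J x (grad τ x), w⟫) ↔
    ∃ k : ℝ, ∀ v : TangentSpace 𝓘(ℝ, E) x,
      d% (transverseEigenvalue J τ) x v = k * ⟪grad τ x, v⟫ := by
  obtain ⟨κ, hκ⟩ := exists_ricci_apply_grad hJ hτ hx
  constructor
  · rintro ⟨c, hc⟩
    refine ⟨κ - c, fun v ↦ ?_⟩
    -- The substitution w = Jv turns dφ(Jw) into -dφ(v) and g(X, w) into g(T, v).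
    have h := hκ (J x v)
    rw [hc, hJ.sq_eq_neg, map_neg, hJ.inner_map_map] at h
    linarith
  · rintro ⟨k, hk⟩
    refine ⟨κ - k, fun w ↦ ?_⟩
    rw [hκ, hk, hJ.inner_apply_left]
    ring

end Ricci

/-! ### The foliation and its conformal one-form -/

section Foliation

variable {J : Π x : M, TangentSpace 𝓘(ℝ, E) x →L[ℝ] TangentSpace 𝓘(ℝ, E) x} {τ : M → ℝ}

theorem grad_mem_potentialDistribution (x : M) :
    grad (E := E) τ x ∈ potentialDistribution J τ x :=
  Submodule.subset_span (Set.mem_insert _ _)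

theorem apply_grad_mem_potentialDistribution (x : M) :
    J x (grad (E := E) τ x) ∈ potentialDistribution J τ x :=
  Submodule.subset_span (Set.mem_insert_of_mem _ rfl)

theorem apply_mem_potentialDistribution (hJ : IsKahler J) {x : M} {v : TangentSpace 𝓘(ℝ, E) x}
    (hv : v ∈ potentialDistribution J τ x) : J x v ∈ potentialDistribution J τ x := by
  obtain ⟨a, b, rfl⟩ := Submodule.mem_span_pair.1 hv
  rw [map_add, map_smul, map_smul, hJ.sq_eq_neg]
  exact Submodule.add_mem _ (Submodule.smul_mem _ _ (apply_grad_mem_potentialDistribution x))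
    (Submodule.smul_mem _ _ (Submodule.neg_mem _ (grad_mem_potentialDistribution x)))

theorem eq_of_mem_potentialDistribution (hJ : IsKahler J) {x : M} (hx : d% τ x ≠ 0)
    {v : TangentSpace 𝓘(ℝ, E) x} (hv : v ∈ potentialDistribution J τ x) :
    v = (⟪grad (E := E) τ x, v⟫ / ⟪grad (E := E) τ x, grad τ x⟫) • grad τ x
      + (⟪J x (grad (E := E) τ x), v⟫ / ⟪grad (E := E) τ x, grad τ x⟫) • J x (grad τ x) := by
  have h := sub_mem_orthogonal hJ hx v
  have h' : v - (⟪grad (E := E) τ x, v⟫ / ⟪grad (E := E) τ x, grad τ x⟫) • grad τ x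
      - (⟪J x (grad (E := E) τ x), v⟫ / ⟪grad (E := E) τ x, grad τ x⟫) • J x (grad τ x) ∈
        potentialDistribution J τ x :=
    Submodule.sub_mem _ (Submodule.sub_mem _ hv
      (Submodule.smul_mem _ _ (grad_mem_potentialDistribution x)))
      (Submodule.smul_mem _ _ (apply_grad_mem_potentialDistribution x))
  rw [← sub_eq_zero, ← sub_sub, ← inner_self_eq_zero (𝕜 := ℝ)]
  exact Submodule.inner_right_of_mem_orthogonal h' h

/-- Modulo the distribution, the covariant derivative of one of its sections is given by the
transverse eigenvalue. -/
theorem exists_leviCivita_sub_mem (hJ : IsKahler J) (hτ : IsSpecialKahlerPotential J τ)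
    {W : Set M} (hW : IsOpen W) (hWU : W ⊆ {x : M | d% τ x ≠ 0})
    {V : Π x : M, TangentSpace 𝓘(ℝ, E) x} (hV : IsSectionOn (potentialDistribution J τ) W V)
    {x : M} (hx : x ∈ W) :
    ∃ f h : ℝ, V x = f • grad τ x + h • J x (grad τ x) ∧
      ∀ u, leviCivita V x u - transverseEigenvalue J τ x • (f • u + h • J x u) ∈
        potentialDistribution J τ x := by
  have hx' := hWU hx
  have hVx : CMDiffAt ∞ (T% V) x := hV.1.contMDiffAt (hW.mem_nhds hx)
  have hT := contMDiffAt_grad (E := E) (hτ.smooth x)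
  have hX := hJ.contMDiffAt_apply hT
  have hQ := inner_grad_self_ne_zero (E := E) hx'
  let f : M → ℝ := fun y ↦ ⟪grad (E := E) τ y, V y⟫ / ⟪grad (E := E) τ y, grad τ y⟫
  let h : M → ℝ := fun y ↦ ⟪J y (grad (E := E) τ y), V y⟫ / ⟪grad (E := E) τ y, grad τ y⟫
  have hf : CMDiffAt ∞ f x := (contMDiffAt_inner hT hVx).div₀ (contMDiffAt_inner hT hT) hQ
  have hh : CMDiffAt ∞ h x := (contMDiffAt_inner hX hVx).div₀ (contMDiffAt_inner hT hT) hQ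
  refine ⟨f x, h x, eq_of_mem_potentialDistribution hJ hx' (hV.2 x hx), fun u ↦ ?_⟩
  have he : V =ᶠ[𝓝 x] ((f • grad τ + h • (fun y ↦ J y (grad τ y) :
      Π y : M, TangentSpace 𝓘(ℝ, E) y) : Π y : M, TangentSpace 𝓘(ℝ, E) y)) := by
    filter_upwards [hW.mem_nhds hx] with y hy
    exact eq_of_mem_potentialDistribution hJ (hWU hy) (hV.2 y hy)
  have s1 := mdiffAt_of_contMDiffAt (hf.smul_section hT)
  have s2 := mdiffAt_of_contMDiffAt (hh.smul_section hX)
  have hS : leviCivita (grad (E := E) τ) x u - transverseEigenvalue J τ x • u ∈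
      potentialDistribution J τ x := by
    rw [leviCivita_grad_eq hJ hτ hx', add_sub_cancel_left]
    exact Submodule.smul_mem _ _ (Submodule.add_mem _
      (Submodule.smul_mem _ _ (grad_mem_potentialDistribution x))
      (Submodule.smul_mem _ _ (apply_grad_mem_potentialDistribution x)))
  have hJS := apply_mem_potentialDistribution hJ hS
  -- Derivatives of the coefficients contribute only vectors of 𝒱, and S ≡ φ modulo 𝒱.
  have heq : leviCivita V x u - transverseEigenvalue J τ x • (f x • u + h x • J x u) =
      f x • (leviCivita (grad τ) x u - transverseEigenvalue J τ x • u)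
      + h x • J x (leviCivita (grad τ) x u - transverseEigenvalue J τ x • u)
      + (d% f x u • grad τ x + d% h x u • J x (grad τ x)) := by
    rw [leviCivita_congr (mdiffAt_of_contMDiffAt hVx) he, leviCivita_add s1 s2,
      _root_.add_apply, leviCivita_smul (hf.mdifferentiableAt (by simp)) (mdiffAt_of_contMDiffAt hT),
      leviCivita_smul (hh.mdifferentiableAt (by simp)) (mdiffAt_of_contMDiffAt hX),
      leviCivita_apply_grad hJ hτ, map_sub, map_smul]
    module
  rw [heq]
  exact Submodule.add_mem _ (Submodule.add_mem _ (Submodule.smul_mem _ _ hS)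
    (Submodule.smul_mem _ _ hJS)) (Submodule.add_mem _
      (Submodule.smul_mem _ _ (grad_mem_potentialDistribution x))
      (Submodule.smul_mem _ _ (apply_grad_mem_potentialDistribution x)))

theorem isTotallyGeodesic_potentialDistribution (hJ : IsKahler J)
    (hτ : IsSpecialKahlerPotential J τ) :
    IsTotallyGeodesic (potentialDistribution J τ) {x : M | d% τ x ≠ 0} := by
  intro W hW hWU V V' hV hV' x hx
  obtain ⟨f, h, -, hu⟩ := exists_leviCivita_sub_mem hJ hτ hW hWU hV' hx
  have hVx := hV.2 x hx
  have h' := Submodule.add_mem _ (hu (V x)) (Submodule.smul_mem _ (transverseEigenvalue J τ x)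
    (Submodule.add_mem _ (Submodule.smul_mem _ f hVx)
      (Submodule.smul_mem _ h (apply_mem_potentialDistribution hJ hVx))))
  rwa [sub_add_cancel] at h'

theorem isComplexFoliationByCurves_potentialDistribution (hJ : IsKahler J)
    (hτ : IsSpecialKahlerPotential J τ) :
    IsComplexFoliationByCurves J (potentialDistribution J τ) {x : M | d% τ x ≠ 0} where
  isOpen := isOpen_setOf_mvfderiv_ne_zero hτ.smooth
  rank_two x hx := finrank_potentialDistribution hJ hx
  smooth x hx := by
    refine ⟨_, isOpen_setOf_mvfderiv_ne_zero hτ.smooth, hx, subset_rfl, grad τ,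
      fun y ↦ J y (grad τ y), ⟨fun y _ ↦ ?_, fun y _ ↦ grad_mem_potentialDistribution y⟩,
      ⟨fun y _ ↦ ?_, fun y _ ↦ apply_grad_mem_potentialDistribution y⟩, fun y _ ↦ rfl⟩
    · exact (contMDiffAt_grad (hτ.smooth y)).contMDiffWithinAt
    · exact (hJ.contMDiffAt_apply (contMDiffAt_grad (hτ.smooth y))).contMDiffWithinAt
  involutive W hW hWU V V' hV hV' x hx := by
    rw [← leviCivita_torsion_free
      (mdiffAt_of_contMDiffAt (hV.1.contMDiffAt (hW.mem_nhds hx)))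
      (mdiffAt_of_contMDiffAt (hV'.1.contMDiffAt (hW.mem_nhds hx)))]
    exact Submodule.sub_mem _
      (isTotallyGeodesic_potentialDistribution hJ hτ W hW hWU V V' hV hV' x hx)
      (isTotallyGeodesic_potentialDistribution hJ hτ W hW hWU V' V hV' hV x hx)
  complex x _ := by
    refine le_antisymm ?_ fun v hv ↦ ?_
    · rw [Submodule.map_le_iff_le_comap]
      exact fun v hv ↦ apply_mem_potentialDistribution hJ hv
    · refine ⟨-J x v, Submodule.neg_mem _ (apply_mem_potentialDistribution hJ hv), ?_⟩
      change J x (-J x v) = v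
      rw [map_neg, hJ.sq_eq_neg, neg_neg]

/-- As J is parallel, (L_V J)Y = J∇_Y V - ∇_{JY} V. Modulo 𝒱 the map u ↦ ∇_u V commutes with J. -/
theorem isHolomorphic_potentialDistribution (hJ : IsKahler J)
    (hτ : IsSpecialKahlerPotential J τ) :
    IsHolomorphic J (potentialDistribution J τ) {x : M | d% τ x ≠ 0} := by
  intro W hW hWU V Y hV hY x hx
  obtain ⟨f, h, -, hu⟩ := exists_leviCivita_sub_mem hJ hτ hW hWU hV hx
  have hVx := mdiffAt_of_contMDiffAt (hV.1.contMDiffAt (hW.mem_nhds hx))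
  have hYx := mdiffAt_of_contMDiffAt (hY.contMDiffAt (hW.mem_nhds hx))
  have h1 := apply_mem_potentialDistribution hJ (hu (Y x))
  have h2 := hu (J x (Y x))
  have h3 := Submodule.sub_mem _ h1 h2
  rw [lieDerivEndo, ← leviCivita_torsion_free hVx (hJ.mdiffAt_apply hYx),
    ← leviCivita_torsion_free hVx hYx, hJ.parallel x Y hYx]
  convert! h3 using 1
  simp only [map_sub, map_add, map_smul]
  abel

/-- This is d(f dτ) = df ∧ dτ, the commutator formula accounting for d(dτ) = 0. -/
theorem mvfderiv_smul_closed {f : M → ℝ} {x : M} (hf : CMDiffAt ∞ f x) (hτ : CMDiffAt ∞ τ x)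
    {Y Z : Π x : M, TangentSpace 𝓘(ℝ, E) x} (hY : CMDiffAt ∞ (T% Y) x)
    (hZ : CMDiffAt ∞ (T% Z) x) :
    d% (fun y ↦ (f y • d% τ y) (Z y)) x (Y x) - d% (fun y ↦ (f y • d% τ y) (Y y)) x (Z x)
        - (f x • d% τ x) (mlieBracket 𝓘(ℝ, E) Y Z x) =
      d% f x (Y x) * d% τ x (Z x) - d% f x (Z x) * d% τ x (Y x) := by
  have h := mvfderiv_mvfderiv_sub hτ hY hZ
  simp only [_root_.smul_apply, smul_eq_mul]
  rw [mvfderiv_fun_mul (hf.mdifferentiableAt (by simp))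
      ((contMDiffAt_mvfderiv hτ hZ).mdifferentiableAt (by simp)),
    mvfderiv_fun_mul (hf.mdifferentiableAt (by simp))
      ((contMDiffAt_mvfderiv hτ hY).mdifferentiableAt (by simp)), ← h]
  simp only [_root_.add_apply, _root_.smul_apply, smul_eq_mul]
  ring

/-- The coefficient of the conformal form `α = (2φ / |∇τ|²) dτ`. -/
def conformalCoeff (J : Π x : M, TangentSpace 𝓘(ℝ, E) x →L[ℝ] TangentSpace 𝓘(ℝ, E) x)
    (τ : M → ℝ) (x : M) : ℝ :=
  2 * transverseEigenvalue J τ x / ⟪grad (E := E) τ x, grad τ x⟫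

theorem contMDiffAt_conformalCoeff (hJ : IsKahler J) (hτ : IsSpecialKahlerPotential J τ) {x : M}
    (hx : d% τ x ≠ 0) : CMDiffAt ∞ (conformalCoeff J τ) x := by
  have hT := contMDiffAt_grad (E := E) (hτ.smooth x)
  exact (contMDiffAt_const.mul (contMDiffAt_transverseEigenvalue hJ hτ hx)).div₀
    (contMDiffAt_inner hT hT) (inner_grad_self_ne_zero hx)

/-- Product rule for (2φ/Q)·Q = 2φ, with dQ(v) = 2g(∇_v T, T) = 2ψ g(T, v). -/
theorem mvfderiv_conformalCoeff (hJ : IsKahler J) (hτ : IsSpecialKahlerPotential J τ) {x : M}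
    (hx : d% τ x ≠ 0) (v : TangentSpace 𝓘(ℝ, E) x) :
    d% (conformalCoeff J τ) x v * ⟪grad (E := E) τ x, grad τ x⟫
      + conformalCoeff J τ x * (2 * gradEigenvalue (E := E) τ x * ⟪grad τ x, v⟫) =
      2 * d% (transverseEigenvalue J τ) x v := by
  have hT := contMDiffAt_grad (E := E) (hτ.smooth x)
  have hc := contMDiffAt_conformalCoeff hJ hτ hx
  have he : (fun y ↦ conformalCoeff J τ y * ⟪grad (E := E) τ y, grad τ y⟫) =ᶠ[𝓝 x]
      fun y ↦ 2 * transverseEigenvalue J τ y := by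
    filter_upwards [eventually_mvfderiv_ne_zero hτ.smooth hx] with y hy
    exact div_mul_cancel₀ _ (inner_grad_self_ne_zero hy)
  have h := congrArg (fun φ ↦ φ v) (mvfderiv_congr he)
  rw [mvfderiv_fun_mul (hc.mdifferentiableAt (by simp))
    ((contMDiffAt_inner hT hT).mdifferentiableAt (by simp)),
    mvfderiv_fun_mul mdifferentiableAt_const
      ((contMDiffAt_transverseEigenvalue hJ hτ hx).mdifferentiableAt (by simp)),
    mvfderiv_const] at h
  simp only [_root_.add_apply, _root_.smul_apply, smul_eq_mul, smul_zero, add_zero] at h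
  rw [leviCivita_metric_apply (mdiffAt_of_contMDiffAt hT) (mdiffAt_of_contMDiffAt hT),
    real_inner_comm (leviCivita (grad τ) x v), inner_leviCivita_grad_comm (hτ.smooth x),
    leviCivita_grad_grad hJ hτ hx] at h
  rw [← h]
  rw [inner_smul_right, real_inner_comm _ v]
  ring

theorem isHomothetic_of_mvfderiv (hJ : IsKahler J) (hτ : IsSpecialKahlerPotential J τ)
    (h : ∀ x : M, d% τ x ≠ 0 → ∃ k : ℝ, ∀ v : TangentSpace 𝓘(ℝ, E) x,
      d% (transverseEigenvalue J τ) x v = k * ⟪grad τ x, v⟫) :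
    IsHomothetic (potentialDistribution J τ) {x : M | d% τ x ≠ 0} := by
  refine ⟨fun x ↦ conformalCoeff J τ x • d% τ x, ⟨?_, ?_, ?_⟩, ?_⟩
  · intro W hW hWU Y hY x hx
    exact ((contMDiffAt_conformalCoeff hJ hτ (hWU hx)).mul (contMDiffAt_mvfderiv (hτ.smooth x)
      (hY.contMDiffAt (hW.mem_nhds hx)))).contMDiffWithinAt
  · intro x _ w hw
    rw [mem_orthogonal_potentialDistribution, inner_grad] at hw
    rw [_root_.smul_apply, hw.1, smul_zero]
  · intro W hW hWU V hV x hx Y Z hY hZ hYx hZx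
    have hQ := inner_grad_self_ne_zero (E := E) (hWU hx)
    obtain ⟨f, g, hVx, hu⟩ := exists_leviCivita_sub_mem hJ hτ hW hWU hV hx
    -- Against transverse vectors, ∇V acts as φ(f + hJ). Symmetrizing kills the skew part hJ and
    -- leaves 2φf, which is α(V).
    have h1 := Submodule.inner_right_of_mem_orthogonal (hu (Y x)) hZx
    have h2 := Submodule.inner_left_of_mem_orthogonal (hu (Z x)) hYx
    rw [lieDerivMetric_eq (mdiffAt_of_contMDiffAt (hV.1.contMDiffAt (hW.mem_nhds hx))) hY hZ,
      _root_.smul_apply, ← inner_grad, hVx, conformalCoeff]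
    simp only [inner_sub_left, inner_sub_right, inner_add_left, inner_add_right, inner_smul_left,
      inner_smul_right, conj_trivial, hJ.inner_apply_left] at h1 h2 ⊢
    have h0 : ⟪grad (E := E) τ x, J x (grad τ x)⟫ = 0 := by
      rw [real_inner_comm, hJ.inner_apply_self]
    rw [h0, smul_eq_mul]
    field_simp
    linear_combination ⟪grad (E := E) τ x, grad τ x⟫ * h1 + ⟪grad (E := E) τ x, grad τ x⟫ * h2
  · intro W hW hWU Y Z hY hZ x hx
    have hQ := inner_grad_self_ne_zero (E := E) (hWU hx)
    rw [mvfderiv_smul_closed (contMDiffAt_conformalCoeff hJ hτ (hWU hx)) (hτ.smooth x)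
      (hY.contMDiffAt (hW.mem_nhds hx)) (hZ.contMDiffAt (hW.mem_nhds hx))]
    obtain ⟨k, hk⟩ := h x (hWU hx)
    have h1 := mvfderiv_conformalCoeff hJ hτ (hWU hx) (Y x)
    have h2 := mvfderiv_conformalCoeff hJ hτ (hWU hx) (Z x)
    rw [hk] at h1 h2
    rw [← inner_grad τ x (Y x), ← inner_grad τ x (Z x)]
    -- Multiplied by Q, the differential of the conformal coefficient is a multiple of dτ, so its
    -- wedge product with dτ vanishes.
    refine (mul_eq_zero.1 ?_).resolve_right hQ
    linear_combination ⟪grad (E := E) τ x, Z x⟫ * h1 - ⟪grad (E := E) τ x, Y x⟫ * h2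

/-- A nonzero transverse vector determines α on 𝒱: testing V = T gives α(T) = 2φ, and V = X gives
α(X) = 0 since X is Killing. On 𝒱^⊥ the form vanishes by definition. -/
theorem IsConformalWith.eq_conformalCoeff_smul (hJ : IsKahler J)
    (hτ : IsSpecialKahlerPotential J τ) {α : Π x : M, TangentSpace 𝓘(ℝ, E) x →L[ℝ] ℝ}
    (hα : IsConformalWith (potentialDistribution J τ) {x : M | d% τ x ≠ 0} α)
    (hE : Module.finrank ℝ E ≠ 2) {x : M} (hx : d% τ x ≠ 0) :
    α x = conformalCoeff J τ x • d% τ x := by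
  have hQ := inner_grad_self_ne_zero (E := E) hx
  obtain ⟨w, hw, hw0⟩ := Submodule.exists_mem_ne_zero_of_ne_bot
    (mt (orthogonal_potentialDistribution_eq_bot_iff hJ hx).1 hE)
  have hww : ⟪w, w⟫ ≠ 0 := inner_self_ne_zero.2 hw0
  have hU := isOpen_setOf_mvfderiv_ne_zero (E := E) hτ.smooth
  have hT : ∀ y, CMDiffAt ∞ (T% (grad τ : Π y : M, TangentSpace 𝓘(ℝ, E) y)) y :=
    fun y ↦ contMDiffAt_grad (hτ.smooth y)
  have hwd := FiberBundle.mdifferentiableAt_extend 𝓘(ℝ, E) E w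
  have hwx : (FiberBundle.extend E w : Π y : M, TangentSpace 𝓘(ℝ, E) y) x = w :=
    FiberBundle.extend_apply_self _ _
  have h1 : α x (grad τ x) = 2 * transverseEigenvalue J τ x := by
    have h := hα.2.2 _ hU subset_rfl (grad τ) ⟨fun y _ ↦ (hT y).contMDiffWithinAt,
      fun y _ ↦ grad_mem_potentialDistribution y⟩ x hx _ _ hwd hwd (by rwa [hwx]) (by rwa [hwx])
    rw [lieDerivMetric_eq (mdiffAt_of_contMDiffAt (hT x)) hwd hwd, hwx,
      (isTransverseEigenvalue_transverseEigenvalue hJ hτ hx).1 w hw, inner_smul_left,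
      inner_smul_right] at h
    refine mul_right_cancel₀ hww (h.symm.trans ?_)
    simp only [conj_trivial]
    ring
  have h2 : α x (J x (grad τ x)) = 0 := by
    have h := hα.2.2 _ hU subset_rfl (fun y ↦ J y (grad τ y))
      ⟨fun y _ ↦ (hJ.contMDiffAt_apply (hT y)).contMDiffWithinAt,
        fun y _ ↦ apply_grad_mem_potentialDistribution y⟩ x hx _ _ hwd hwd
        (by rwa [hwx]) (by rwa [hwx])
    rw [hτ.killing.2 x _ _ hwd hwd, hwx] at h
    exact (mul_eq_zero.1 h.symm).resolve_right hww
  ext v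
  have h3 := hα.2.1 x hx _ (sub_mem_orthogonal hJ hx v)
  simp only [map_sub, map_smul, smul_eq_mul, h1, h2, mul_zero, sub_zero] at h3
  rw [_root_.smul_apply, ← inner_grad, smul_eq_mul, conformalCoeff, sub_eq_zero.1 h3]
  ring

theorem exists_isOpen_contMDiffOn_extend {U : Set M} (hU : IsOpen U) {x : M} (hx : x ∈ U)
    (v : TangentSpace 𝓘(ℝ, E) x) : ∃ W : Set M, IsOpen W ∧ x ∈ W ∧ W ⊆ U ∧
      CMDiff[W] ∞ (T% (FiberBundle.extend E v : Π y : M, TangentSpace 𝓘(ℝ, E) y)) := by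
  obtain ⟨s, hs, h⟩ := FiberBundle.exists_contMDiffOn_extend (k := ∞) 𝓘(ℝ, E) E v
  obtain ⟨W, hWs, hW, hxW⟩ := mem_nhds_iff.1 (Filter.inter_mem hs (hU.mem_nhds hx))
  exact ⟨W, hW, hxW, fun y hy ↦ (hWs hy).2, h.mono fun y hy ↦ (hWs hy).1⟩

theorem exists_mvfderiv_eq_of_isHomothetic (hJ : IsKahler J) (hτ : IsSpecialKahlerPotential J τ)
    (h : IsHomothetic (potentialDistribution J τ) {x : M | d% τ x ≠ 0}) {x : M}
    (hx : d% τ x ≠ 0) : ∃ k : ℝ, ∀ v : TangentSpace 𝓘(ℝ, E) x,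
      d% (transverseEigenvalue J τ) x v = k * ⟪grad τ x, v⟫ := by
  have hQ := inner_grad_self_ne_zero (E := E) hx
  by_cases hE : Module.finrank ℝ E = 2
  -- Here T and X span the tangent space and Xφ = 0, so dφ is determined by its value on T.
  · refine ⟨d% (transverseEigenvalue J τ) x (grad τ x) / ⟪grad (E := E) τ x, grad τ x⟫, fun v ↦ ?_⟩
    have hv := sub_mem_orthogonal hJ hx v
    rw [(orthogonal_potentialDistribution_eq_bot_iff hJ hx).2 hE, Submodule.mem_bot] at hv
    have h1 := congrArg (d% (transverseEigenvalue J τ) x) hv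
    simp only [map_sub, map_smul, smul_eq_mul, (mvfderiv_eigenvalues_apply_grad hJ hτ hx).1,
      mul_zero, sub_zero, map_zero] at h1
    rw [sub_eq_zero.1 h1]
    ring
  obtain ⟨α, hα, hclosed⟩ := h
  have hUo := isOpen_setOf_mvfderiv_ne_zero (E := E) hτ.smooth
  have hT : ∀ y, CMDiffAt ∞ (T% (grad τ : Π y : M, TangentSpace 𝓘(ℝ, E) y)) y :=
    fun y ↦ contMDiffAt_grad (hτ.smooth y)
  have hαe : ∀ᶠ y in 𝓝 x, α y = conformalCoeff J τ y • d% τ y := by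
    filter_upwards [eventually_mvfderiv_ne_zero hτ.smooth hx] with y hy
    exact hα.eq_conformalCoeff_smul hJ hτ hE hy
  -- Closedness evaluated on `v` and T: the coefficient of α has differential proportional to dτ.
  have key : ∀ v : TangentSpace 𝓘(ℝ, E) x, d% (conformalCoeff J τ) x v *
      ⟪grad (E := E) τ x, grad τ x⟫ =
      d% (conformalCoeff J τ) x (grad τ x) * ⟪grad τ x, v⟫ := by
    intro v
    obtain ⟨W, hW, hxW, hWU, hsm⟩ := exists_isOpen_contMDiffOn_extend hUo hx v
    have hc := hclosed W hW hWU (FiberBundle.extend E v) (grad τ) hsm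
      (fun y _ ↦ (hT y).contMDiffWithinAt) x hxW
    have e1 : ∀ Z : Π y : M, TangentSpace 𝓘(ℝ, E) y,
        (fun y ↦ α y (Z y)) =ᶠ[𝓝 x] fun y ↦ (conformalCoeff J τ y • d% τ y) (Z y) := by
      intro Z
      filter_upwards [hαe] with y hy
      rw [hy]
    rw [mvfderiv_congr (e1 _), mvfderiv_congr (e1 _), hαe.self_of_nhds,
      mvfderiv_smul_closed (contMDiffAt_conformalCoeff hJ hτ hx) (hτ.smooth x)
        (contMDiffAt_extend_vector v) (hT x), FiberBundle.extend_apply_self,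
      ← inner_grad τ x (grad τ x), ← inner_grad τ x v] at hc
    linarith
  refine ⟨(d% (conformalCoeff J τ) x (grad τ x)
    + conformalCoeff J τ x * (2 * gradEigenvalue (E := E) τ x)) / 2, fun v ↦ ?_⟩
  have h1 := mvfderiv_conformalCoeff hJ hτ hx v
  rw [key] at h1
  linarith

end Foliation

end

end KahlerFoliation

theorem proposition3p2
    {E : Type*} [NormedAddCommGroup E] [NormedSpace ℝ E] [FiniteDimensional ℝ E]
    {M : Type*} [TopologicalSpace M] [ChartedSpace E M] [IsManifold 𝓘(ℝ, E) ∞ M]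
    [RiemannianBundle (fun x : M ↦ TangentSpace 𝓘(ℝ, E) x)]
    [IsContMDiffRiemannianBundle 𝓘(ℝ, E) ∞ E (fun x : M ↦ TangentSpace 𝓘(ℝ, E) x)]
    (J : Π x : M, TangentSpace 𝓘(ℝ, E) x →L[ℝ] TangentSpace 𝓘(ℝ, E) x)
    (hJ : KahlerFoliation.IsKahler J) (τ : M → ℝ)
    (hτ : KahlerFoliation.IsSpecialKahlerPotential J τ)
    (U : Set M) (hU : U = {x : M | d% τ x ≠ 0})
    (D : Π x : M, Submodule ℝ (TangentSpace 𝓘(ℝ, E) x))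
    (hD : D = KahlerFoliation.potentialDistribution J τ) :
    (KahlerFoliation.IsComplexFoliationByCurves J D U ∧
      KahlerFoliation.IsTotallyGeodesic D U ∧
      KahlerFoliation.IsHolomorphic J D U ∧
      KahlerFoliation.IsHomothetic D U) ↔
    ∀ x ∈ U, ∃ c : ℝ, ∀ w : TangentSpace 𝓘(ℝ, E) x,
      KahlerFoliation.ricci x (J x (KahlerFoliation.grad τ x)) w =
        c * inner ℝ (J x (KahlerFoliation.grad τ x)) w := by
  subst hU hD
  constructor
  · rintro ⟨-, -, -, h⟩ x hx
    exact (KahlerFoliation.ricci_eigenvector_iff hJ hτ hx).2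
      (KahlerFoliation.exists_mvfderiv_eq_of_isHomothetic hJ hτ h hx)
  · intro h
    exact ⟨KahlerFoliation.isComplexFoliationByCurves_potentialDistribution hJ hτ,
      KahlerFoliation.isTotallyGeodesic_potentialDistribution hJ hτ,
      KahlerFoliation.isHolomorphic_potentialDistribution hJ hτ,
      KahlerFoliation.isHomothetic_of_mvfderiv hJ hτ fun x hx ↦
        (KahlerFoliation.ricci_eigenvector_iff hJ hτ hx).1 (h x hx)⟩
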